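/- **Conventions.** Let $\mathbb K$ be a field of characteristic $0$. A permutation of size $n\ge 0$ is a word $\sigma=\sigma_1\cdots\sigma_n$ which rearranges $1\,2\cdots n$; let $\mathfrak S$ be the set of all permutations, $\mathfrak S_n$ those of size $n$. The algebra $\mathbf{FQSym}$ has linear basis $(\mathbf F_\sigma)_{\sigma\in\mathfrak S}$ and product $\mathbf F_\sigma\cdot\mathbf F_\nu=\sum_\pi \mathbf F_\pi$, where $\pi$ runs over the shuffles of $\sigma$ with the word obtained by adding $|\sigma|$ to each letter of $\nu$. The permutohedron order $\le_{\mathrm P}$ on $\mathfrak S_n$ is generated by $u\,ab\,v <_{\mathrm P} u\,ba\,v$ for letters $a<b$. For $\nu,\pi\in\mathfrak S$, let $\nu\diagup\pi$ be the concatenation of $\nu$ and of $\pi$ with all letters increased by $|\nu|$. A nonempty permutation $\sigma$ is *connected* if $\sigma=\nu\diagup\pi$ implies $\nu=\sigma$ or $\pi=\sigma$, and *anti-connected* if its mirror image $\sigma_n\cdots\sigma_1$ is connected. The *canopy* of a planar binary tree $T$ is the $0/1$ word obtained by reading its leaves from left to right, except the first and the last one, writing $0$ for a leaf that is a right child and $1$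 for a leaf that is a left child. A *pair of twin binary trees* is a pair $J=(T_L,T_R)$ of binary trees with the same number of nodes (possibly $0$) whose canopies differ in every position; let $\mathcal{TBT}$ be the set of these pairs. For binary trees, $T_0\diagup T_1$ is obtained by grafting $T_0$ on the leftmost leaf of $T_1$, and $T_0\diagdown T_1$ by grafting $T_1$ on the rightmost leaf of $T_0$. For $J_0=(T^0_L,T^0_R)$ and $J_1=(T^1_L,T^1_R)$ in $\mathcal{TBT}$ put $$J_0\diagup J_1=(T^0_L\diagdown T^1_L,\;T^0_R\diagup T^1_R),\qquad J_0\diagdown J_1=(T^0_L\diagup T^1_L,\;T^0_R\diagdown T^1_R),$$ which are again in $\mathcal{TBT}$. The *$\mathsf P$-symbol* $\mathsf P(\sigma)=(T_L,T_R)$ of a permutation $\sigma$ is the pair of (unlabeled shapes of) binary search trees obtained by inserting at the leaves, with the binary search tree insertion algorithm, the letters of $\sigma$ from left to right for $T_L$ and from right to left for $T_R$. On $\mathcal{TBT}$, let $J\le_{\mathrm B}J'$ if there are permutations $\sigma\le_{\mathrm P}\nu$ with $\mathsf P(\sigma)=J$ and $\mathsf P(\nu)=J'$. Put $$\mathbf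 P_J=\sum_{\mathsf P(\sigma)=J}\mathbf F_\sigma,\qquad \mathbf E_J=\sum_{J\le_{\mathrm B}J'}\mathbf P_{J'},\qquad \mathbf H_J=\sum_{J'\le_{\mathrm B}J}\mathbf P_{J'}.$$ Let $\mathbf{Baxter}$ be the subalgebra of $\mathbf{FQSym}$ generated by the $\mathbf P_J$, $J\in\mathcal{TBT}$. Finally $J\in\mathcal{TBT}$ is *connected* (resp. *anti-connected*) if all permutations $\sigma$ with $\mathsf P(\sigma)=J$ are connected (resp. anti-connected). **Theorem.** The algebra $\mathbf{Baxter}$ is the linear span of the family $(\mathbf P_J)_{J\in\mathcal{TBT}}$. The families $(\mathbf E_J)_{J\in\mathcal{TBT}}$ and $(\mathbf H_J)_{J\in\mathcal{TBT}}$ are linear bases of $\mathbf{Baxter}$, and they are multiplicative: for all $J_0,J_1\in\mathcal{TBT}$, $$\mathbf E_{J_0}\cdot\mathbf E_{J_1}=\mathbf E_{J_0\diagup J_1},\qquad \mathbf H_{J_0}\cdot\mathbf H_{J_1}=\mathbf H_{J_0\diagdown J_1}.$$ The algebra $\mathbf{Baxter}$ is free (as a unital associative $\mathbb K$-algebra)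 on the elements $\mathbf E_J$ with $J$ a connected pair of twin binary trees, and also free on the elements $\mathbf H_J$ with $J$ an anti-connected pair of twin binary trees. -/

import Mathlib

noncomputable section

namespace BaxterAlg

/-! ### Words and permutations

The alphabet is `ℕ`, the letter `a_i` being `i`. A permutation of size `n` is identified with the
word `σ₁ ⋯ σₙ`, a rearrangement of `1 2 ⋯ n`. -/

/-- The word `w` is a permutation of `1, …, |w|` in one-line notation. -/
def IsPermWord (w : List ℕ) : Prop := w.Perm (List.range' 1 w.length)

/-- The set of all permutations (of all sizes `n ≥ 0`), as words. -/
abbrev PermWord : Type := {w : List ℕ // IsPermWord w}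

/-- The word obtained from `w` by adding `m` to every letter. -/
def shift (m : ℕ) (w : List ℕ) : List ℕ := w.map (· + m)

/-- The shuffle product of two words, a formal sum of words (with multiplicities). -/
def shuffle : List ℕ → List ℕ → Multiset (List ℕ)
  | u, [] => {u}
  | [], b :: v => {b :: v}
  | a :: u, b :: v =>
      (shuffle u (b :: v)).map (List.cons a) + (shuffle (a :: u) v).map (List.cons b)
termination_by u v => u.length + v.length

theorem shuffle_nil_right (u : List ℕ) : shuffle u [] = {u} := by
  cases u <;> simp [shuffle]

theorem shuffle_nil_left (v : List ℕ) : shuffle [] v = {v} := by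
  cases v <;> simp [shuffle]

theorem shuffle_cons_cons (a b : ℕ) (u v : List ℕ) :
    shuffle (a :: u) (b :: v) =
      (shuffle u (b :: v)).map (List.cons a) + (shuffle (a :: u) v).map (List.cons b) := by
  rw [shuffle]

theorem perm_of_mem_shuffle (u v : List ℕ) : ∀ w ∈ shuffle u v, w.Perm (u ++ v) := by
  induction u generalizing v with
  | nil => intro w hw; rw [shuffle_nil_left] at hw; simp_all
  | cons a u ihu =>
    induction v with
    | nil => intro w hw; rw [shuffle_nil_right] at hw; simp_all
    | cons b v ihv =>
      intro w hw
      rw [shuffle_cons_cons, Multiset.mem_add, Multiset.mem_map, Multiset.mem_map] at hw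
      rcases hw with ⟨x, hx, rfl⟩ | ⟨x, hx, rfl⟩
      · exact (ihu _ x hx).cons a
      · exact ((ihv x hx).cons b).trans List.perm_middle.symm

theorem isPermWord_concat {u v : List ℕ} (hu : IsPermWord u) (hv : IsPermWord v) :
    IsPermWord (u ++ shift u.length v) := by
  unfold IsPermWord shift at *
  rw [List.length_append, List.length_map, List.range'_append_1.symm]
  refine hu.append ?_
  refine (hv.map _).trans (List.Perm.of_eq ?_)
  rw [List.map_congr_left (g := (u.length + ·)) (fun _ _ => add_comm _ _), List.map_add_range',
    add_comm]

theorem IsPermWord.of_perm {u v : List ℕ} (h : u.Perm v) (hv : IsPermWord v) : IsPermWord u := by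
  unfold IsPermWord at *
  rw [h.length_eq]
  exact h.trans hv

theorem isPermWord_of_mem_shuffle {u v : List ℕ} (hu : IsPermWord u) (hv : IsPermWord v) :
    ∀ w ∈ shuffle u (shift u.length v), IsPermWord w := fun w hw =>
  IsPermWord.of_perm (perm_of_mem_shuffle _ _ w hw) (isPermWord_concat hu hv)

namespace PermWord

/-- The size of a permutation. -/
def size (σ : PermWord) : ℕ := σ.1.length

/-- The empty permutation. -/
def empty : PermWord := ⟨[], by simp [IsPermWord]⟩

open scoped Classical in
/-- The finite set of permutations of size `n`. -/
def ofSize (n : ℕ) : Finset PermWord :=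
  (List.range' 1 n).permutations.toFinset.subtype IsPermWord

/-- `σ ╱ ν`: the concatenation of `σ` and of the letters of `ν` incremented by `|σ|`. -/
def slash (σ ν : PermWord) : PermWord :=
  ⟨σ.1 ++ shift σ.1.length ν.1, isPermWord_concat σ.2 ν.2⟩

/-- The mirror image of a permutation. -/
def mirror (σ : PermWord) : PermWord :=
  ⟨σ.1.reverse, IsPermWord.of_perm (List.reverse_perm _) σ.2⟩

/-- `σ` is a nonempty permutation such that `σ = ν ╱ π` implies `ν = σ` or `π = σ`. -/
def IsConnected (σ : PermWord) : Prop :=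
  σ ≠ empty ∧ ∀ ν π : PermWord, σ = slash ν π → ν = σ ∨ π = σ

/-- `σ` is anti-connected if its mirror image is connected. -/
def IsAntiConnected (σ : PermWord) : Prop := IsConnected (mirror σ)

/-- The covering relation of the permutohedron: `σ = u a b v` and `ν = u b a v` with `a < b`. -/
def Covers (σ ν : PermWord) : Prop :=
  ∃ (u v : List ℕ) (a b : ℕ), a < b ∧ σ.1 = u ++ a :: b :: v ∧ ν.1 = u ++ b :: a :: v

/-- The (right) permutohedron order. -/
def Le (σ ν : PermWord) : Prop := Relation.ReflTransGen Covers σ ν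

/-- The shifted shuffle product of two permutations. -/
def shiftedShuffle (σ ν : PermWord) : Multiset PermWord :=
  (shuffle σ.1 (shift σ.1.length ν.1)).pmap Subtype.mk (isPermWord_of_mem_shuffle σ.2 ν.2)

end PermWord

/-! ### Binary trees and pairs of twin binary trees -/

/-- Orientations of the leaves of a binary tree, from left to right: `true` for a leaf that is a
left child, `false` for a leaf that is a right child. The first argument is the orientation of the
tree itself. -/
def leaves {α : Type*} : Bool → BinaryTree α → List Bool
  | s, .nil => [s]
  | _, .node _ l r => leaves true l ++ leaves false r

/-- The canopy: the orientations of all leaves but the first and the last one, with `0 = false`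
for a leaf oriented to the right and `1 = true` otherwise. -/
def canopy {α : Type*} (T : BinaryTree α) : List Bool := (leaves true T).tail.dropLast

/-- `T₀ ╱ T₁`: graft `T₀` on the leftmost leaf of `T₁`. -/
def treeOver {α : Type*} (T₀ : BinaryTree α) : BinaryTree α → BinaryTree α
  | .nil => T₀
  | .node a l r => .node a (treeOver T₀ l) r

/-- `T₀ ╲ T₁`: graft `T₁` on the rightmost leaf of `T₀`. -/
def treeUnder {α : Type*} : BinaryTree α → BinaryTree α → BinaryTree α
  | .nil, T₁ => T₁
  | .node a l r, T₁ => .node a l (treeUnder r T₁)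

/-- `(T_L, T_R)` is a pair of twin binary trees: same number of nodes, complementary canopies. -/
def IsTwin (J : BinaryTree Unit × BinaryTree Unit) : Prop :=
  J.1.numNodes = J.2.numNodes ∧ List.Forall₂ (· ≠ ·) (canopy J.1) (canopy J.2)

/-- The set of all (unlabeled) pairs of twin binary trees. -/
abbrev TwinPair : Type := {J : BinaryTree Unit × BinaryTree Unit // IsTwin J}

theorem treeOver_nil {α : Type*} (T : BinaryTree α) : treeOver .nil T = T := by
  induction T with
  | nil => rfl
  | node a l r ihl _ => simp [treeOver, ihl]

theorem treeUnder_nil {α : Type*} (T : BinaryTree α) : treeUnder T .nil = T := by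
  induction T with
  | nil => rfl
  | node a l r _ ihr => simp [treeUnder, ihr]

theorem numNodes_treeOver {α : Type*} (S T : BinaryTree α) :
    (treeOver S T).numNodes = S.numNodes + T.numNodes := by
  induction T with
  | nil => simp [treeOver]
  | node a l r ihl _ => simp [treeOver, ihl]; omega

theorem numNodes_treeUnder {α : Type*} (S T : BinaryTree α) :
    (treeUnder S T).numNodes = S.numNodes + T.numNodes := by
  induction S with
  | nil => simp [treeUnder]
  | node a l r _ ihr => simp [treeUnder, ihr]; omega

theorem leaves_ne_nil {α : Type*} (s : Bool) (T : BinaryTree α) : leaves s T ≠ [] := by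
  induction T generalizing s with
  | nil => simp [leaves]
  | node a l r ihl _ => simp [leaves, ihl]

theorem exists_leaves_true {α : Type*} (T : BinaryTree α) : ∃ x, leaves true T = true :: x := by
  induction T with
  | nil => exact ⟨[], rfl⟩
  | node a l r ihl _ =>
    obtain ⟨x, hx⟩ := ihl
    exact ⟨x ++ leaves false r, by simp [leaves, hx]⟩

theorem exists_leaves_false {α : Type*} (T : BinaryTree α) :
    ∃ x, leaves false T = x ++ [false] := by
  induction T with
  | nil => exact ⟨[], rfl⟩
  | node a l r _ ihr =>
    obtain ⟨x, hx⟩ := ihr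
    exact ⟨leaves true l ++ x, by simp [leaves, hx]⟩

theorem leaves_node {α : Type*} (s : Bool) (a : α) (l r : BinaryTree α) :
    leaves s (.node a l r) = true :: (canopy (.node a l r) ++ [false]) := by
  obtain ⟨x, hx⟩ := exists_leaves_true l
  obtain ⟨y, hy⟩ := exists_leaves_false r
  have h : true :: (x ++ (y ++ [false])) = true :: ((x ++ y) ++ [false]) := by simp
  simp only [canopy, leaves, hx, hy, List.cons_append, List.tail_cons]
  rw [← List.append_assoc, List.dropLast_concat]

theorem leaves_treeUnder {α : Type*} (s : Bool) (S : BinaryTree α) (a : α) (l r : BinaryTree α) :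
    leaves s (treeUnder S (.node a l r)) =
      (leaves s S).dropLast ++ leaves s (.node a l r) := by
  induction S generalizing s with
  | nil => simp [treeUnder, leaves]
  | node b l' r' _ ihr =>
    have h : ∀ t, leaves t (.node b l' r') = leaves true l' ++ leaves false r' := fun _ => rfl
    rw [treeUnder, leaves, ihr, h, List.dropLast_append_of_ne_nil (leaves_ne_nil _ _)]
    simp [leaves]

theorem leaves_treeOver {α : Type*} (s : Bool) (a : α) (l r : BinaryTree α) (T : BinaryTree α) :
    leaves s (treeOver (.node a l r) T) =
      leaves s (.node a l r) ++ (leaves s T).tail := by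
  induction T generalizing s with
  | nil => simp [treeOver, leaves]
  | node b l' r' ihl _ =>
    have h : ∀ t, leaves t (.node b l' r') = leaves true l' ++ leaves false r' := fun _ => rfl
    rw [treeOver, leaves, ihl, h, List.tail_append_of_ne_nil (leaves_ne_nil _ _)]
    simp [leaves]

theorem canopy_treeUnder {α : Type*} (a b : α) (l r l' r' : BinaryTree α) :
    canopy (treeUnder (.node a l r) (.node b l' r')) =
      canopy (.node a l r) ++ true :: canopy (.node b l' r') := by
  conv_lhs => rw [canopy, leaves_treeUnder, leaves_node, leaves_node]
  rw [← List.cons_append, List.dropLast_concat, List.cons_append, List.tail_cons,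
    ← List.cons_append, ← List.append_assoc, List.dropLast_concat]

theorem canopy_treeOver {α : Type*} (a b : α) (l r l' r' : BinaryTree α) :
    canopy (treeOver (.node a l r) (.node b l' r')) =
      canopy (.node a l r) ++ false :: canopy (.node b l' r') := by
  conv_lhs => rw [canopy, leaves_treeOver, leaves_node, leaves_node]
  rw [List.tail_cons, List.cons_append, List.tail_cons, ← List.append_assoc,
    List.dropLast_concat]
  simp

theorem eq_nil_of_numNodes_eq_zero {α : Type*} {T : BinaryTree α} (h : T.numNodes = 0) :
    T = .nil := by
  cases T with
  | nil => rfl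
  | node a l r => simp at h

theorem isTwin_over {A B C D : BinaryTree Unit} (h₀ : IsTwin (A, B)) (h₁ : IsTwin (C, D)) :
    IsTwin (treeUnder A C, treeOver B D) := by
  refine ⟨?_, ?_⟩
  · have := h₀.1
    have := h₁.1
    simp only [numNodes_treeUnder, numNodes_treeOver] at *
    omega
  · cases A with
    | nil =>
      have hB : B = .nil := eq_nil_of_numNodes_eq_zero (h₀.1.symm.trans (by simp))
      subst hB
      simpa [treeUnder, treeOver_nil] using h₁.2
    | node a l r =>
      cases C with
      | nil =>
        have hD : D = .nil := eq_nil_of_numNodes_eq_zero (h₁.1.symm.trans (by simp))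
        subst hD
        simpa [treeOver, treeUnder_nil] using h₀.2
      | node c l' r' =>
        cases B with
        | nil => exact absurd h₀.1 (by simp)
        | node b m s =>
          cases D with
          | nil => exact absurd h₁.1 (by simp)
          | node d m' s' =>
            simp only [canopy_treeUnder, canopy_treeOver]
            exact List.rel_append h₀.2 (List.Forall₂.cons (by simp) h₁.2)

theorem IsTwin.swap {A B : BinaryTree Unit} (h : IsTwin (A, B)) : IsTwin (B, A) :=
  ⟨h.1.symm, (List.Forall₂.flip h.2).imp fun _ _ hab => Ne.symm hab⟩

namespace TwinPair

/-- The number of nodes of each of the two trees. -/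
def size (J : TwinPair) : ℕ := J.1.1.numNodes

open scoped Classical in
/-- The finite set of pairs of twin binary trees with `n` nodes each. -/
def ofSize (n : ℕ) : Finset TwinPair :=
  (BinaryTree.treesOfNumNodesEq n ×ˢ BinaryTree.treesOfNumNodesEq n).subtype IsTwin

/-- `J₀ ╱ J₁ = (T⁰_L ╲ T¹_L, T⁰_R ╱ T¹_R)`. -/
def slash (J₀ J₁ : TwinPair) : TwinPair :=
  ⟨(treeUnder J₀.1.1 J₁.1.1, treeOver J₀.1.2 J₁.1.2), isTwin_over J₀.2 J₁.2⟩

/-- `J₀ ╲ J₁ = (T⁰_L ╱ T¹_L, T⁰_R ╲ T¹_R)`. -/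
def backslash (J₀ J₁ : TwinPair) : TwinPair :=
  ⟨(treeOver J₀.1.1 J₁.1.1, treeUnder J₀.1.2 J₁.1.2),
    (isTwin_over (IsTwin.swap J₀.2) (IsTwin.swap J₁.2)).swap⟩

end TwinPair

/-! ### The Baxter P-symbol -/

/-- Leaf insertion of a letter into a left binary search tree. -/
def insertLeft (T : BinaryTree ℕ) (a : ℕ) : BinaryTree ℕ :=
  match T with
  | .nil => .node a .nil .nil
  | .node b l r => if a < b then .node b (insertLeft l a) r else .node b l (insertLeft r a)

/-- Leaf insertion of a letter into a right binary search tree. -/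
def insertRight (T : BinaryTree ℕ) (a : ℕ) : BinaryTree ℕ :=
  match T with
  | .nil => .node a .nil .nil
  | .node b l r => if a ≤ b then .node b (insertRight l a) r else .node b l (insertRight r a)

/-- The shape of a labeled binary tree. -/
def shape (T : BinaryTree ℕ) : BinaryTree Unit := T.map fun _ => ()

/-- The Baxter `P`-symbol of a word: the left binary search tree obtained by leaf inserting its
letters from left to right, and the right binary search tree obtained by leaf inserting its letters
from right to left. -/
def pSymbol (w : List ℕ) : BinaryTree ℕ × BinaryTree ℕ :=
  (w.foldl insertLeft .nil, w.reverse.foldl insertRight .nil)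

/-- The unlabeled pair of binary trees underlying the `P`-symbol of a permutation. -/
def pShape (σ : PermWord) : BinaryTree Unit × BinaryTree Unit :=
  (shape (pSymbol σ.1).1, shape (pSymbol σ.1).2)

namespace TwinPair

/-- The Baxter order: `J₀ ≤ J₁` if there are permutations `σ ≤ ν` (in the permutohedron) with
`P(σ) = J₀` and `P(ν) = J₁`. -/
def Le (J₀ J₁ : TwinPair) : Prop :=
  ∃ σ ν : PermWord, PermWord.Le σ ν ∧ pShape σ = J₀.1 ∧ pShape ν = J₁.1

/-- All permutations with `P`-symbol `J` are connected. -/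
def IsConnected (J : TwinPair) : Prop :=
  ∀ σ : PermWord, pShape σ = J.1 → σ.IsConnected

/-- All permutations with `P`-symbol `J` are anti-connected. -/
def IsAntiConnected (J : TwinPair) : Prop :=
  ∀ σ : PermWord, pShape σ = J.1 → σ.IsAntiConnected

end TwinPair

/-! ### The algebra `FQSym` -/

/-- The vector space `FQSym` with basis indexed by all permutations. -/
def FQSym (K : Type*) [CommRing K] : Type _ := PermWord →₀ K

namespace FQSym

variable {K : Type*} [CommRing K]

instance : AddCommGroup (FQSym K) := inferInstanceAs (AddCommGroup (PermWord →₀ K))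

instance : Module K (FQSym K) := inferInstanceAs (Module K (PermWord →₀ K))

/-- The fundamental basis `(F_σ)`. -/
def F (K : Type*) [CommRing K] : Module.Basis PermWord K (FQSym K) :=
  Module.Basis.ofRepr (LinearEquiv.refl K (PermWord →₀ K))

/-- `F_σ · F_ν`: the sum of the `F_π` for `π` in the shifted shuffle of `σ` and `ν`. -/
def prodF (K : Type*) [CommRing K] (σ ν : PermWord) : FQSym K :=
  ((PermWord.shiftedShuffle σ ν).map (F K)).sum

/-- The bilinear extension of `F_σ · F_ν`. -/
def mulLin (K : Type*) [CommRing K] : FQSym K →ₗ[K] FQSym K →ₗ[K] FQSym K :=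
  (F K).constr K fun σ => (F K).constr K fun ν => prodF K σ ν

instance : Mul (FQSym K) := ⟨fun x y => mulLin K x y⟩

instance : One (FQSym K) := ⟨F K PermWord.empty⟩

theorem mul_def (x y : FQSym K) : x * y = mulLin K x y := rfl

theorem one_def : (1 : FQSym K) = F K PermWord.empty := rfl

theorem F_mul_F (σ ν : PermWord) : F K σ * F K ν = prodF K σ ν := by
  rw [mul_def, mulLin, Module.Basis.constr_basis, Module.Basis.constr_basis]

open scoped Classical in
/-- `F_w` if the word `w` is a permutation, `0` otherwise. -/
def wordF (K : Type*) [CommRing K] (w : List ℕ) : FQSym K :=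
  if h : IsPermWord w then F K ⟨w, h⟩ else 0

theorem sum_shiftedShuffle {M : Type*} [AddCommMonoid M] (σ ν : PermWord) (f : PermWord → M)
    (g : List ℕ → M) (h : ∀ π : PermWord, π.size = σ.size + ν.size → f π = g π.1) :
    ((PermWord.shiftedShuffle σ ν).map f).sum =
      ((shuffle σ.1 (shift σ.1.length ν.1)).map g).sum := by
  rw [PermWord.shiftedShuffle, Multiset.map_pmap, ← Multiset.pmap_eq_map IsPermWord g]
  · refine congrArg Multiset.sum (Multiset.pmap_congr _ fun w hw h₁ _ => h ⟨w, h₁⟩ ?_)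
    have := (perm_of_mem_shuffle _ _ w hw).length_eq
    simpa [PermWord.size, shift] using this
  · exact isPermWord_of_mem_shuffle σ.2 ν.2

theorem prodF_eq (σ ν : PermWord) :
    prodF K σ ν = ((shuffle σ.1 (shift σ.1.length ν.1)).map (wordF K)).sum :=
  sum_shiftedShuffle σ ν _ _ fun π _ => by rw [wordF, dif_pos π.2]

theorem shuffle_map (f : ℕ → ℕ) (u v : List ℕ) :
    shuffle (u.map f) (v.map f) = (shuffle u v).map (List.map f) := by
  induction u generalizing v with
  | nil => simp [shuffle_nil_left]
  | cons a u ihu =>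
    induction v with
    | nil => simp [shuffle_nil_right]
    | cons b v ihv =>
      have h₁ := ihu (b :: v)
      rw [List.map_cons] at h₁ ihv
      rw [List.map_cons, List.map_cons, shuffle_cons_cons, shuffle_cons_cons, h₁, ihv]
      simp [Multiset.map_map]

theorem shuffle_assoc_sum {M : Type*} [AddCommMonoid M] (n : ℕ) (u v w : List ℕ)
    (hn : u.length + v.length + w.length ≤ n) (f : List ℕ → M) :
    ((shuffle u v).map fun x => ((shuffle x w).map f).sum).sum =
      ((shuffle v w).map fun y => ((shuffle u y).map f).sum).sum := by
  induction n generalizing u v w f with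
  | zero =>
    have hu : u = [] := List.length_eq_zero_iff.1 (by omega)
    have hv : v = [] := List.length_eq_zero_iff.1 (by omega)
    have hw : w = [] := List.length_eq_zero_iff.1 (by omega)
    subst hu hv hw
    simp [shuffle_nil_left]
  | succ n ih =>
    rcases u with _ | ⟨a, u⟩
    · simp [shuffle_nil_left]
    rcases v with _ | ⟨b, v⟩
    · simp [shuffle_nil_left, shuffle_nil_right]
    rcases w with _ | ⟨c, w⟩
    · simp [shuffle_nil_right]
    simp only [List.length_cons] at hn
    have h₁ := ih u (b :: v) (c :: w) (by simp; omega) (f ∘ List.cons a)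
    have h₂ := ih (a :: u) v (c :: w) (by simp; omega) (f ∘ List.cons b)
    have h₃ := ih (a :: u) (b :: v) w (by simp; omega) (f ∘ List.cons c)
    simp only [shuffle_cons_cons, Multiset.map_add, Multiset.sum_add, Multiset.map_map,
      Function.comp_def, Multiset.sum_map_add] at h₁ h₂ h₃ ⊢
    rw [h₁, h₂, add_add_add_comm, h₃]
    abel

theorem F_mul_assoc (σ ν τ : PermWord) :
    F K σ * F K ν * F K τ = F K σ * (F K ν * F K τ) := by
  have hl : F K σ * F K ν * F K τ =
      ((shuffle σ.1 (shift σ.1.length ν.1)).map fun x =>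
        ((shuffle x (shift (σ.1.length + ν.1.length) τ.1)).map (wordF K)).sum).sum := by
    rw [F_mul_F, prodF, mul_def, ← LinearMap.flip_apply, map_multiset_sum, Multiset.map_map]
    refine sum_shiftedShuffle σ ν _ _ fun π hπ => ?_
    rw [Function.comp_apply, LinearMap.flip_apply, ← mul_def, F_mul_F, prodF_eq]
    simp only [PermWord.size] at hπ
    rw [hπ]
  have hr : F K σ * (F K ν * F K τ) =
      ((shuffle ν.1 (shift ν.1.length τ.1)).map fun y =>
        ((shuffle σ.1 (shift σ.1.length y)).map (wordF K)).sum).sum := by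
    rw [F_mul_F ν τ, prodF, mul_def, map_multiset_sum, Multiset.map_map]
    refine sum_shiftedShuffle ν τ _ _ fun π _ => ?_
    rw [Function.comp_apply, ← mul_def, F_mul_F, prodF_eq]
  have hs : shift (σ.1.length + ν.1.length) τ.1 = shift σ.1.length (shift ν.1.length τ.1) := by
    simp only [shift, List.map_map]
    exact List.map_congr_left fun x _ => by simp only [Function.comp_apply]; omega
  rw [hl, hr, shuffle_assoc_sum _ _ _ _ le_rfl, hs]
  conv_lhs => rw [shift, shift, shuffle_map, Multiset.map_map]
  rfl

@[elab_as_elim]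
theorem induction_F {p : FQSym K → Prop} (x : FQSym K) (zero : p 0)
    (add : ∀ x y, p x → p y → p (x + y)) (smul : ∀ (c : K) x, p x → p (c • x))
    (basis : ∀ σ, p (F K σ)) : p x := by
  refine Submodule.span_induction (p := fun x _ => p x) ?_ zero (fun x y _ _ => add x y)
    (fun c x _ => smul c x) ((F K).mem_span x)
  rintro _ ⟨σ, rfl⟩
  exact basis σ

theorem add_mul' (x y z : FQSym K) : (x + y) * z = x * z + y * z := by
  simp only [mul_def, map_add, LinearMap.add_apply]

theorem mul_add' (x y z : FQSym K) : x * (y + z) = x * y + x * z := by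
  simp only [mul_def, map_add]

theorem zero_mul' (x : FQSym K) : 0 * x = 0 := by
  simp only [mul_def, map_zero, LinearMap.zero_apply]

theorem mul_zero' (x : FQSym K) : x * 0 = 0 := by
  simp only [mul_def, map_zero]

theorem smul_mul' (c : K) (x y : FQSym K) : c • x * y = c • (x * y) := by
  simp only [mul_def, map_smul, LinearMap.smul_apply]

theorem mul_smul' (c : K) (x y : FQSym K) : x * c • y = c • (x * y) := by
  simp only [mul_def, map_smul]

theorem mul_assoc' (x y z : FQSym K) : x * y * z = x * (y * z) := by
  induction x using induction_F with
  | zero => simp only [zero_mul']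
  | add x₁ x₂ h₁ h₂ => simp only [add_mul', h₁, h₂]
  | smul c x h => simp only [smul_mul', h]
  | basis σ =>
  induction y using induction_F with
  | zero => simp only [zero_mul', mul_zero']
  | add y₁ y₂ h₁ h₂ => simp only [add_mul', mul_add', h₁, h₂]
  | smul c y h => simp only [smul_mul', mul_smul', h]
  | basis ν =>
  induction z using induction_F with
  | zero => simp only [mul_zero']
  | add z₁ z₂ h₁ h₂ => simp only [mul_add', h₁, h₂]
  | smul c z h => simp only [mul_smul', h]
  | basis τ => exact F_mul_assoc σ ν τ

theorem one_mul' (x : FQSym K) : 1 * x = x := by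
  induction x using induction_F with
  | zero => exact mul_zero' 1
  | add x₁ x₂ h₁ h₂ => rw [mul_add', h₁, h₂]
  | smul c x h => rw [mul_smul', h]
  | basis σ =>
    rw [one_def, F_mul_F, prodF_eq]
    simp [PermWord.empty, shift, shuffle_nil_left, wordF, σ.2]

theorem mul_one' (x : FQSym K) : x * 1 = x := by
  induction x using induction_F with
  | zero => exact zero_mul' 1
  | add x₁ x₂ h₁ h₂ => rw [add_mul', h₁, h₂]
  | smul c x h => rw [smul_mul', h]
  | basis σ =>
    rw [one_def, F_mul_F, prodF_eq]
    simp [PermWord.empty, shift, shuffle_nil_right, wordF, σ.2]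

instance : Ring (FQSym K) :=
  { (inferInstance : AddCommGroup (FQSym K)), (inferInstance : Mul (FQSym K)),
    (inferInstance : One (FQSym K)) with
    left_distrib := mul_add'
    right_distrib := add_mul'
    zero_mul := zero_mul'
    mul_zero := mul_zero'
    mul_assoc := mul_assoc'
    one_mul := one_mul'
    mul_one := mul_one' }

instance : Algebra K (FQSym K) := Algebra.ofModule smul_mul' mul_smul'

end FQSym

/-! ### The algebra `Baxter` and its multiplicative bases -/

open scoped Classical in
/-- `P_J`: the sum of the `F_σ` over all permutations `σ` with `P`-symbol `J`. -/
def P (K : Type*) [CommRing K] (J : TwinPair) : FQSym K :=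
  ∑ σ ∈ PermWord.ofSize J.size with pShape σ = J.1, FQSym.F K σ

open scoped Classical in
/-- `E_J`: the sum of the `P_{J'}` over all `J' ≥ J` in the Baxter order. -/
def E (K : Type*) [CommRing K] (J : TwinPair) : FQSym K :=
  ∑ J' ∈ TwinPair.ofSize J.size with TwinPair.Le J J', P K J'

open scoped Classical in
/-- `H_J`: the sum of the `P_{J'}` over all `J' ≤ J` in the Baxter order. -/
def H (K : Type*) [CommRing K] (J : TwinPair) : FQSym K :=
  ∑ J' ∈ TwinPair.ofSize J.size with TwinPair.Le J' J, P K J'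

/-- The algebra `Baxter`: the subalgebra of `FQSym` generated by the `P_J`. -/
def Baxter (K : Type*) [CommRing K] : Subalgebra K (FQSym K) :=
  Algebra.adjoin K (Set.range (P K))

theorem E_mem (K : Type*) [CommRing K] (J : TwinPair) : E K J ∈ Baxter K :=
  Subalgebra.sum_mem _ fun J' _ => Algebra.subset_adjoin ⟨J', rfl⟩

theorem H_mem (K : Type*) [CommRing K] (J : TwinPair) : H K J ∈ Baxter K :=
  Subalgebra.sum_mem _ fun J' _ => Algebra.subset_adjoin ⟨J', rfl⟩

end BaxterAlg

end

open BaxterAlg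

namespace BaxterAlg

/-! ### Relative order of the letters of a word -/

/-! The proof rests on the fact that every class of permutations with the same `P`-symbol $J$ has a
minimum `minPerm J` for the permutohedron order, and that this minimum controls the Baxter order:
$J\le_{\mathrm B}\mathsf P(\nu)$ if and only if `minPerm J` is below $\nu$ (`le_twinOf_iff`).

The permutohedron order is inclusion of inversion sets (`PermWord.le_iff`), and in a binary search
tree a node is an ancestor of another when its letter is read before all the letters between them
(`anc_bst_iff`). So the two trees of $J$ impose certain inversions. Their transitive closure is
again an inversion set, because the descendants of a node form an interval. Complementarity of the
canopies ensures that it creates no inversion forbidden by the trees, so the resulting permutation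
has symbol $J$ (`pShape_minPerm`). Imposed inversions persist when going up in the order and depend
only on the class (`minPerm_le`).

Hence $\mathbf E_J$ is the sum of the $\mathbf F_\nu$ over all $\nu$ above `minPerm J` (`E_eq`). In
$\mathbf{FQSym}$ such sums multiply by concatenation: $\pi$ is above $\sigma\diagup\nu$ exactly when
it is in the shifted shuffle of some $\alpha\ge\sigma$ and $\beta\ge\nu$ (`slash_le_iff`). With
`minPerm_slash` this gives the product rule for $\mathbf E$. The passage from $\mathbf P$ to
$\mathbf E$ is unitriangular, so both families have the same span, which is closed under products
and therefore is the whole algebra.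

Freeness becomes a statement on monoids: under $\diagup$ the twin pairs are freely generated by the
connected ones (`bijective_foldr_slash`). Everything about $\mathbf H$ follows from the automorphism
of $\mathbf{FQSym}$ that reverses words: it exchanges the two trees, reverses the order and sends
$\mathbf E$ to $\mathbf H$ (`mirror_E`). -/

/-- The letter `i` occurs somewhere before the letter `j` in the word `w`. -/
def Bef (w : List ℕ) (i j : ℕ) : Prop := [i, j].Sublist w

theorem bef_nil (i j : ℕ) : ¬ Bef [] i j := by simp [Bef]

theorem bef_cons (a : ℕ) (w : List ℕ) (i j : ℕ) :
    Bef (a :: w) i j ↔ (i = a ∧ j ∈ w) ∨ Bef w i j := by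
  simp only [Bef, List.sublist_cons_iff]
  constructor
  · rintro (h | ⟨r, hr, h⟩)
    · exact .inr h
    · rw [List.cons.injEq] at hr
      obtain ⟨rfl, rfl⟩ := hr
      exact .inl ⟨rfl, by simpa using h⟩
  · rintro (⟨rfl, h⟩ | h)
    · exact .inr ⟨[j], rfl, by simpa using h⟩
    · exact .inl h

theorem Bef.mem {w : List ℕ} {i j : ℕ} (h : Bef w i j) : i ∈ w ∧ j ∈ w :=
  ⟨h.subset (by simp), h.subset (by simp)⟩

theorem bef_append (u v : List ℕ) (i j : ℕ) :
    Bef (u ++ v) i j ↔ Bef u i j ∨ Bef v i j ∨ (i ∈ u ∧ j ∈ v) := by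
  induction u with
  | nil => simp [bef_nil]
  | cons a u ih =>
    simp only [List.cons_append, bef_cons, ih, List.mem_append, List.mem_cons]
    tauto

theorem bef_reverse (w : List ℕ) (i j : ℕ) : Bef w.reverse i j ↔ Bef w j i := by
  unfold Bef
  rw [← List.reverse_sublist, List.reverse_reverse]
  rfl

theorem bef_filter (p : ℕ → Bool) (w : List ℕ) (i j : ℕ) :
    Bef (w.filter p) i j ↔ Bef w i j ∧ p i ∧ p j := by
  induction w with
  | nil => simp [bef_nil]
  | cons a w ih =>
    by_cases h : p a
    · rw [List.filter_cons_of_pos h, bef_cons, bef_cons, ih, List.mem_filter]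
      constructor
      · rintro (⟨rfl, h1, h2⟩ | h1)
        · exact ⟨.inl ⟨rfl, h1⟩, h, h2⟩
        · exact ⟨.inr h1.1, h1.2⟩
      · rintro ⟨⟨rfl, h1⟩ | h1, h2, h3⟩
        · exact .inl ⟨rfl, h1, h3⟩
        · exact .inr ⟨h1, h2, h3⟩
    · rw [List.filter_cons_of_neg h, bef_cons, ih]
      constructor
      · rintro ⟨h1, h2⟩
        exact ⟨.inr h1, h2⟩
      · rintro ⟨⟨rfl, h1⟩ | h1, h2, h3⟩
        · exact absurd h2 h
        · exact ⟨h1, h2, h3⟩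

theorem bef_shift (m : ℕ) (w : List ℕ) (i j : ℕ) :
    Bef (shift m w) (i + m) (j + m) ↔ Bef w i j := by
  induction w with
  | nil => simp [bef_nil, shift]
  | cons a w ih =>
    simp only [shift, List.map_cons, bef_cons, List.mem_map] at ih ⊢
    rw [ih]
    simp

theorem mem_shift {m : ℕ} {w : List ℕ} {i : ℕ} : i ∈ shift m w ↔ m ≤ i ∧ i - m ∈ w := by
  simp only [shift, List.mem_map]
  constructor
  · rintro ⟨a, h, rfl⟩
    simpa using h
  · rintro ⟨h, h'⟩
    exact ⟨_, h', by omega⟩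

theorem Bef.asymm {w : List ℕ} (hw : w.Nodup) {i j : ℕ} (h : Bef w i j) : ¬ Bef w j i := by
  induction w with
  | nil => exact absurd h (bef_nil _ _)
  | cons a w ih =>
    rw [List.nodup_cons] at hw
    rw [bef_cons] at h ⊢
    rintro (⟨rfl, h'⟩ | h')
    · rcases h with ⟨rfl, h⟩ | h
      · exact hw.1 h
      · exact hw.1 h.mem.2
    · rcases h with ⟨rfl, h⟩ | h
      · exact hw.1 h'.mem.2
      · exact ih hw.2 h h'

theorem bef_or_bef {w : List ℕ} {i j : ℕ} (hi : i ∈ w) (hj : j ∈ w) (h : i ≠ j) :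
    Bef w i j ∨ Bef w j i := by
  induction w with
  | nil => simp at hi
  | cons a w ih =>
    rw [bef_cons, bef_cons]
    rw [List.mem_cons] at hi hj
    rcases hi with rfl | hi
    · exact .inl (.inl ⟨rfl, hj.resolve_left (Ne.symm h)⟩)
    · rcases hj with rfl | hj
      · exact .inr (.inl ⟨rfl, hi⟩)
      · rcases ih hi hj with h | h
        · exact .inl (.inr h)
        · exact .inr (.inr h)

theorem Bef.ne {w : List ℕ} (hw : w.Nodup) {i j : ℕ} (h : Bef w i j) : i ≠ j := by
  rintro rfl
  exact h.asymm hw h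

theorem Bef.trans {w : List ℕ} (hw : w.Nodup) {i j k : ℕ} (h : Bef w i j) (h' : Bef w j k) :
    Bef w i k := by
  induction w with
  | nil => exact absurd h (bef_nil _ _)
  | cons a w ih =>
    rw [List.nodup_cons] at hw
    rw [bef_cons] at h h' ⊢
    rcases h' with ⟨rfl, h'⟩ | h'
    · rcases h with ⟨rfl, h⟩ | h
      · exact absurd h hw.1
      · exact absurd h.mem.2 hw.1
    · rcases h with ⟨rfl, h⟩ | h
      · exact .inl ⟨rfl, h'.mem.2⟩
      · exact .inr (ih hw.2 h h')

/-- Every inversion of `u` is an inversion of `v`. -/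
def InvLe (u v : List ℕ) : Prop := ∀ i j, i < j → Bef u j i → Bef v j i

/-- Both words are sorted for the order of occurrence in `v`, and two rearrangements of one another
that are sorted for an antisymmetric relation coincide. -/
theorem eq_of_bef {u v : List ℕ} (h : u.Perm v) (hu : u.Nodup)
    (huv : ∀ i j, Bef u i j → Bef v i j) : u = v := by
  refine h.eq_of_pairwise (le := fun i j => i ∈ u → j ∈ u → i = j ∨ Bef v i j) ?_ ?_ ?_
  · intro a b ha hb hab hba
    have hb := h.mem_iff.2 hb
    rcases hab ha hb with h1 | h1
    · exact h1
    rcases hba hb ha with h2 | h2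
    · exact h2.symm
    exact absurd h2 (h1.asymm (h.nodup_iff.1 hu))
  · rw [List.pairwise_iff_forall_sublist]
    exact fun hab _ _ => .inr (huv _ _ hab)
  · rw [List.pairwise_iff_forall_sublist]
    exact fun hab _ _ => .inr hab

theorem InvLe.antisymm {u v : List ℕ} (h : u.Perm v) (hu : u.Nodup)
    (huv : InvLe u v) (hvu : InvLe v u) : u = v := by
  have hv := h.nodup_iff.1 hu
  refine eq_of_bef h hu fun i j hij => ?_
  rcases lt_trichotomy i j with hlt | rfl | hlt
  · refine (bef_or_bef (h.mem_iff.1 hij.mem.1) (h.mem_iff.1 hij.mem.2) hlt.ne).resolve_right ?_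
    exact fun h' => hij.asymm hu (hvu _ _ hlt h')
  · exact absurd rfl (hij.ne hu)
  · exact huv _ _ hlt hij

theorem InvLe.trans {u v w : List ℕ} (h : InvLe u v) (h' : InvLe v w) : InvLe u w :=
  fun i j hij hu => h' i j hij (h i j hij hu)

theorem InvLe.refl (u : List ℕ) : InvLe u u := fun _ _ _ h => h

/-! ### The permutohedron order -/

/-- The covering relation of the permutohedron, on words. -/
def WordCovers (u v : List ℕ) : Prop :=
  ∃ (x y : List ℕ) (a b : ℕ), a < b ∧ u = x ++ a :: b :: y ∧ v = x ++ b :: a :: y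

theorem WordCovers.perm {u v : List ℕ} (h : WordCovers u v) : u.Perm v := by
  obtain ⟨x, y, a, b, _, rfl, rfl⟩ := h
  exact (List.Perm.swap _ _ _).append_left _

theorem WordCovers.cons {u v : List ℕ} (c : ℕ) (h : WordCovers u v) :
    WordCovers (c :: u) (c :: v) := by
  obtain ⟨x, y, a, b, hab, rfl, rfl⟩ := h
  exact ⟨c :: x, y, a, b, hab, rfl, rfl⟩

theorem WordCovers.invLe {u v : List ℕ} (h : WordCovers u v) : InvLe u v := by
  obtain ⟨x, y, a, b, hab, rfl, rfl⟩ := h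
  intro i j hij
  simp only [bef_append, bef_cons, List.mem_cons]
  rintro (h | ((⟨rfl, rfl | h⟩ | ⟨rfl, h⟩ | h) | h))
  · exact .inl h
  · omega
  all_goals tauto

theorem reflTransGen_move (a : ℕ) (x y : List ℕ) (h : ∀ c ∈ x, c < a) :
    Relation.ReflTransGen WordCovers (x ++ a :: y) (a :: (x ++ y)) := by
  induction x with
  | nil => exact .refl
  | cons c x ih =>
    have h1 := ih fun d hd => h d (List.mem_cons_of_mem _ hd)
    exact (h1.lift (List.cons c) fun _ _ => WordCovers.cons c).tail
      ⟨[], x ++ y, c, a, h c (by simp), rfl, rfl⟩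

/-- Induction on `v`. Any letter preceding the first letter `a` of `v` in `u` is smaller than `a`: a
larger one would form an inversion of `u` that `v` does not have. So `a` can be moved to the front
of `u` by upward covers. -/
theorem reflTransGen_of_invLe {u v : List ℕ} (hp : u.Perm v) (hu : u.Nodup) (h : InvLe u v) :
    Relation.ReflTransGen WordCovers u v := by
  induction v generalizing u with
  | nil => rw [List.perm_nil.1 hp]
  | cons a v ih =>
    have ha : a ∈ u := hp.mem_iff.2 (by simp)
    obtain ⟨x, y, rfl⟩ := List.append_of_mem ha
    have hv := hp.nodup_iff.1 hu
    have hx : ∀ c ∈ x, c < a := by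
      intro c hc
      have hca : Bef (x ++ a :: y) c a := by
        rw [bef_append]
        exact .inr (.inr ⟨hc, by simp⟩)
      by_contra hlt
      have hne := hca.ne hu
      have h1 := h a c (by omega) hca
      have hcv : c ∈ a :: v := hp.mem_iff.1 hca.mem.1
      exact h1.asymm hv ((bef_cons _ _ _ _).2 (.inl ⟨rfl, (List.mem_cons.1 hcv).resolve_left hne⟩))
    refine (reflTransGen_move a x y hx).trans ?_
    have hp' : (x ++ y).Perm v := (List.perm_middle.symm.trans hp).cons_inv
    have hu' : (a :: (x ++ y)).Nodup := List.perm_middle.nodup_iff.1 hu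
    refine (ih hp' (List.nodup_cons.1 hu').2 ?_).lift (List.cons a) fun _ _ => WordCovers.cons a
    intro i j hij hb
    have h1 : Bef (x ++ a :: y) j i := by
      rw [bef_append] at hb
      rw [bef_append, bef_cons]
      simp only [List.mem_cons]
      tauto
    have h2 := h i j hij h1
    rw [bef_cons] at h2
    rcases h2 with ⟨rfl, _⟩ | h2
    · exact absurd hb.mem.1 (List.nodup_cons.1 hu').1
    · exact h2

theorem IsPermWord.nodup {w : List ℕ} (h : IsPermWord w) : w.Nodup :=
  h.nodup_iff.2 (List.nodup_range' ..)

theorem IsPermWord.mem_iff {w : List ℕ} (h : IsPermWord w) {i : ℕ} :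
    i ∈ w ↔ 1 ≤ i ∧ i ≤ w.length := by
  rw [List.Perm.mem_iff h, List.mem_range'_1]
  omega

theorem IsPermWord.perm {u v : List ℕ} (hu : IsPermWord u) (hv : IsPermWord v)
    (h : u.length = v.length) : u.Perm v := by
  unfold IsPermWord at hu hv
  rw [h] at hu
  exact hu.trans hv.symm

namespace PermWord

theorem le_iff {σ ν : PermWord} : Le σ ν ↔ σ.size = ν.size ∧ InvLe σ.1 ν.1 := by
  constructor
  · intro h
    induction h with
    | refl => exact ⟨rfl, InvLe.refl _⟩
    | tail _ hc ih =>
      have hc : WordCovers _ _ := hc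
      exact ⟨ih.1.trans hc.perm.length_eq, ih.2.trans hc.invLe⟩
  · rintro ⟨hs, hi⟩
    obtain ⟨v, hv⟩ := ν
    have h := reflTransGen_of_invLe (σ.2.perm hv hs) σ.2.nodup hi
    clear hs hi
    induction h with
    | refl => exact .refl
    | tail _ hc ih => exact (ih (IsPermWord.of_perm hc.perm hv)).tail hc

theorem Le.size_eq {σ ν : PermWord} (h : Le σ ν) : σ.size = ν.size := (le_iff.1 h).1

theorem Le.antisymm {σ ν : PermWord} (h : Le σ ν) (h' : Le ν σ) : σ = ν := by
  rw [le_iff] at h h'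
  exact Subtype.ext (h.2.antisymm (σ.2.perm ν.2 h.1) σ.2.nodup h'.2)

theorem le_mirror {σ ν : PermWord} (h : Le σ ν) : Le (mirror ν) (mirror σ) := by
  induction h with
  | refl => exact .refl
  | tail _ hc ih =>
    refine .head ?_ ih
    obtain ⟨x, y, a, b, hab, h1, h2⟩ := hc
    exact ⟨y.reverse, x.reverse, a, b, hab, by simp [mirror, h2], by simp [mirror, h1]⟩

theorem mirror_mirror (σ : PermWord) : mirror (mirror σ) = σ :=
  Subtype.ext (List.reverse_reverse _)

theorem mem_ofSize {n : ℕ} {σ : PermWord} : σ ∈ ofSize n ↔ σ.size = n := by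
  simp only [ofSize, Finset.mem_subtype, List.mem_toFinset, List.mem_permutations]
  constructor
  · intro h
    simpa [size] using h.length_eq
  · rintro rfl
    exact σ.2

/-- All letters up to $|\sigma|$ are used by `σ`, so those of `x` exceed $|\sigma|$ and can be
shifted down. -/
theorem exists_eq_slash {w : PermWord} {σ : PermWord} {x : List ℕ} (h : w.1 = σ.1 ++ x) :
    ∃ ν : PermWord, w = slash σ ν ∧ ν.size = x.length := by
  have hx : ∀ i ∈ x, σ.1.length < i := by
    intro i hi
    by_contra hlt
    have hw := w.2.nodup
    have hiw : i ∈ w.1 := by rw [h]; simp [hi]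
    have h1 := (w.2.mem_iff.1 hiw).1
    rw [h, List.nodup_append] at hw
    exact hw.2.2 i (σ.2.mem_iff.2 ⟨h1, by omega⟩) i hi rfl
  have hs : shift σ.1.length (x.map (· - σ.1.length)) = x := by
    rw [shift, List.map_map]
    conv_rhs => rw [← List.map_id x]
    refine List.map_congr_left fun i hi => ?_
    have := hx i hi
    simp only [Function.comp_apply, id]
    omega
  have hxp : x.Perm (List.range' (1 + σ.1.length) x.length) := by
    have hw := w.2
    unfold IsPermWord at hw
    rw [h, List.length_append, ← List.range'_append_1] at hw
    exact (List.perm_append_left_iff σ.1).1 (hw.trans (σ.2.symm.append_right _))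
  refine ⟨⟨x.map (· - σ.1.length), ?_⟩, Subtype.ext ?_, by simp [size]⟩
  · unfold IsPermWord
    refine (hxp.map _).trans (List.Perm.of_eq ?_)
    rw [List.length_map]
    apply List.ext_getElem <;> simp
    intro i _
    omega
  · change w.1 = σ.1 ++ shift σ.1.length (x.map (· - σ.1.length))
    rw [hs]
    exact h

theorem length_slash (σ ν : PermWord) : (slash σ ν).1.length = σ.1.length + ν.1.length := by
  simp [slash, shift]

theorem size_slash (σ ν : PermWord) : (slash σ ν).size = σ.size + ν.size := length_slash σ ν

end PermWord

/-! ### Shapes of binary search trees -/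

theorem foldl_insertLeft_node (w : List ℕ) (b : ℕ) (l r : BinaryTree ℕ) :
    w.foldl insertLeft (.node b l r) =
      .node b ((w.filter (· < b)).foldl insertLeft l)
        ((w.filter (¬ · < b)).foldl insertLeft r) := by
  induction w generalizing l r with
  | nil => rfl
  | cons a w ih =>
    by_cases h : a < b
    · simp [insertLeft, h, ih]
    · simp [insertLeft, h, ih, Nat.le_of_not_lt h]

theorem foldl_insertRight_node (w : List ℕ) (b : ℕ) (l r : BinaryTree ℕ) :
    w.foldl insertRight (.node b l r) =
      .node b ((w.filter (· ≤ b)).foldl insertRight l)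
        ((w.filter (¬ · ≤ b)).foldl insertRight r) := by
  induction w generalizing l r with
  | nil => rfl
  | cons a w ih =>
    by_cases h : a ≤ b
    · simp [insertRight, h, ih]
    · simp [insertRight, h, ih, Nat.lt_of_not_le h]

/-- The two insertion rules differ only on ties, absent from a word without repetition. The bound
`n` allows the induction to pass to filtered subwords. Consequently a single function `bst`
describes both trees of the symbol. -/
theorem foldl_insertRight_eq (n : ℕ) (w : List ℕ) (hn : w.length ≤ n) (hw : w.Nodup) :
    w.foldl insertRight .nil = w.foldl insertLeft .nil := by
  induction n generalizing w with
  | zero => rw [List.length_eq_zero_iff.1 (by omega : w.length = 0)]; rfl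
  | succ n ih =>
    cases w with
    | nil => rfl
    | cons a w =>
      rw [List.nodup_cons] at hw
      rw [List.foldl_cons, List.foldl_cons, insertLeft, insertRight, foldl_insertLeft_node,
        foldl_insertRight_node]
      rw [List.length_cons] at hn
      have h1 : w.filter (fun x => decide (x ≤ a)) = w.filter (fun x => decide (x < a)) := by
        refine List.filter_congr fun x hx => ?_
        have : x ≠ a := fun h => hw.1 (h ▸ hx)
        simp only [decide_eq_decide]
        omega
      have h2 : w.filter (fun x => decide (¬ x ≤ a)) = w.filter (fun x => decide (¬ x < a)) := by
        refine List.filter_congr fun x hx => ?_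
        have : x ≠ a := fun h => hw.1 (h ▸ hx)
        simp only [decide_eq_decide]
        omega
      rw [h1, h2, ih _ ((List.length_filter_le ..).trans (by omega)) (hw.2.filter _),
        ih _ ((List.length_filter_le ..).trans (by omega)) (hw.2.filter _)]

/-- The shape of the binary search tree of a word, read from left to right. -/
def bst (w : List ℕ) : BinaryTree Unit := shape (w.foldl insertLeft .nil)

theorem bst_nil : bst [] = .nil := rfl

theorem bst_cons (a : ℕ) (w : List ℕ) :
    bst (a :: w) = .node () (bst (w.filter (· < a))) (bst (w.filter (¬ · < a))) := by
  rw [bst, List.foldl_cons, insertLeft, foldl_insertLeft_node]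
  rfl

theorem pShape_eq (σ : PermWord) : pShape σ = (bst σ.1, bst σ.1.reverse) := by
  unfold pShape pSymbol bst
  rw [foldl_insertRight_eq _ _ le_rfl (List.nodup_reverse.2 σ.2.nodup)]

/-- Induction on words along the recursion of binary search trees. -/
theorem bst_induction {p : List ℕ → Prop} (nil : p [])
    (cons : ∀ a w, p (w.filter (· < a)) → p (w.filter (¬ · < a)) → p (a :: w)) (w : List ℕ) :
    p w := by
  induction hn : w.length using Nat.strong_induction_on generalizing w with
  | _ n ih =>
    cases w with
    | nil => exact nil
    | cons a w =>
      rw [List.length_cons] at hn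
      exact cons a w
        (ih _ (lt_of_le_of_lt (List.length_filter_le ..) (by omega)) _ rfl)
        (ih _ (lt_of_le_of_lt (List.length_filter_le ..) (by omega)) _ rfl)

theorem length_filter_lt_add (a : ℕ) (w : List ℕ) :
    (w.filter (· < a)).length + (w.filter (¬ · < a)).length = w.length := by
  have := List.length_eq_length_filter_add (l := w) (fun x => decide (x < a))
  simp only [decide_not]
  omega

theorem numNodes_bst (w : List ℕ) : (bst w).numNodes = w.length := by
  induction w using bst_induction with
  | nil => rfl
  | cons a w h1 h2 =>
    rw [bst_cons, BinaryTree.numNodes, h1, h2, List.length_cons, length_filter_lt_add]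

theorem bst_shift (m : ℕ) (w : List ℕ) : bst (shift m w) = bst w := by
  induction w using bst_induction with
  | nil => rfl
  | cons a w h1 h2 =>
    rw [shift, List.map_cons, bst_cons, bst_cons, ← h1, ← h2, shift, shift,
      List.filter_map, List.filter_map]
    congr 3 <;> simp [Function.comp_def]

/-- At every root met, the letters of `v` go right, so they are all inserted at the end of the
rightmost branch. -/
theorem bst_append_of_lt {u v : List ℕ} (h : ∀ i ∈ u, ∀ j ∈ v, i < j) :
    bst (u ++ v) = treeUnder (bst u) (bst v) := by
  induction u using bst_induction with
  | nil => rfl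
  | cons a u h1 h2 =>
    have hv1 : v.filter (· < a) = [] := by
      rw [List.filter_eq_nil_iff]
      intro j hj
      have := h a (by simp) j hj
      simp only [decide_eq_true_eq]
      omega
    have hv2 : v.filter (¬ · < a) = v := by
      rw [List.filter_eq_self]
      intro j hj
      have := h a (by simp) j hj
      simp only [decide_eq_true_eq]
      omega
    rw [List.cons_append, bst_cons, bst_cons, treeUnder, ← h2, List.filter_append,
      List.filter_append, hv1, hv2, List.append_nil]
    exact fun i hi => h i (List.mem_cons_of_mem _ (List.mem_of_mem_filter hi))

theorem bst_append_of_gt {u v : List ℕ} (h : ∀ i ∈ u, ∀ j ∈ v, i < j) :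
    bst (v ++ u) = treeOver (bst u) (bst v) := by
  induction v using bst_induction with
  | nil => rfl
  | cons a v h1 h2 =>
    have hv1 : u.filter (· < a) = u := by
      rw [List.filter_eq_self]
      intro j hj
      have := h j hj a (by simp)
      simp only [decide_eq_true_eq]
      omega
    have hv2 : u.filter (¬ · < a) = [] := by
      rw [List.filter_eq_nil_iff]
      intro j hj
      have := h j hj a (by simp)
      simp only [decide_eq_true_eq]
      omega
    rw [List.cons_append, bst_cons, bst_cons, treeOver, ← h1, List.filter_append,
      List.filter_append, hv1, hv2, List.append_nil]
    exact fun i hi j hj => h i hi j (List.mem_cons_of_mem _ (List.mem_of_mem_filter hj))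

theorem lt_of_mem_of_mem_shift {u v : List ℕ} (hu : IsPermWord u) (hv : IsPermWord v) :
    ∀ i ∈ u, ∀ j ∈ shift u.length v, i < j := by
  intro i hi j hj
  rw [mem_shift, hv.mem_iff] at hj
  rw [hu.mem_iff] at hi
  omega

theorem pShape_slash (σ ν : PermWord) :
    pShape (PermWord.slash σ ν) =
      (treeUnder (pShape σ).1 (pShape ν).1, treeOver (pShape σ).2 (pShape ν).2) := by
  rw [pShape_eq, pShape_eq, pShape_eq]
  have h := lt_of_mem_of_mem_shift σ.2 ν.2
  have h1 := bst_append_of_lt h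
  -- In the mirror image the large letters are read first, so the right tree is grafted on the
  -- opposite side.
  have h2 := bst_append_of_gt (u := σ.1.reverse) (v := (shift σ.1.length ν.1).reverse)
    (by simpa using h)
  rw [bst_shift] at h1
  have h3 : (shift σ.1.length ν.1).reverse = shift σ.1.length ν.1.reverse := List.map_reverse.symm
  rw [← List.reverse_append, h3, bst_shift] at h2
  exact Prod.ext h1 h2

theorem pShape_mirror (σ : PermWord) : pShape (PermWord.mirror σ) = (pShape σ).swap := by
  rw [pShape_eq, pShape_eq]
  simp [PermWord.mirror]

/-! ### Ancestors in binary trees -/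

/-- `Anc m T i j`: when the nodes of `T` are labeled by `m + 1, m + 2, …` in symmetric order, the
node `i` is an ancestor of the node `j` (or equal to it). -/
def Anc (m : ℕ) : BinaryTree Unit → ℕ → ℕ → Prop
  | .nil, _, _ => False
  | .node _ l r, i, j =>
      (i = m + l.numNodes + 1 ∧ m < j ∧ j ≤ m + l.numNodes + 1 + r.numNodes) ∨
        Anc m l i j ∨ Anc (m + l.numNodes + 1) r i j

theorem Anc.bounds {m : ℕ} {T : BinaryTree Unit} {i j : ℕ} (h : Anc m T i j) :
    m < i ∧ i ≤ m + T.numNodes ∧ m < j ∧ j ≤ m + T.numNodes := by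
  induction T generalizing m with
  | nil => exact h.elim
  | node a l r ihl ihr =>
    rw [BinaryTree.numNodes]
    rcases h with h | h | h
    · omega
    · have := ihl h
      omega
    · have := ihr h
      omega

/-- The descendants of a node, itself included, form an interval in symmetric order. All the
combinatorics of imposed inversions comes from this. -/
theorem Anc.between {m : ℕ} {T : BinaryTree Unit} {i j k : ℕ} (h : Anc m T i j)
    (hk : min i j ≤ k) (hk' : k ≤ max i j) : Anc m T i k := by
  induction T generalizing m with
  | nil => exact h.elim
  | node a l r ihl ihr =>
    rcases h with h | h | h
    · exact .inl (by omega)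
    · exact .inr (.inl (ihl h))
    · exact .inr (.inr (ihr h))

theorem Anc.antisymm {m : ℕ} {T : BinaryTree Unit} {i j : ℕ} (h : Anc m T i j)
    (h' : Anc m T j i) : i = j := by
  induction T generalizing m with
  | nil => exact h.elim
  | node a l r ihl ihr =>
    rcases h with h1 | h1 | h1 <;> rcases h' with h2 | h2 | h2
    · omega
    · have := h2.bounds; omega
    · have := h2.bounds; omega
    · have := h1.bounds; omega
    · exact ihl h1 h2
    · have := h1.bounds; have := h2.bounds; omega
    · have := h1.bounds; omega
    · have := h1.bounds; have := h2.bounds; omega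
    · exact ihr h1 h2

theorem length_leaves (s : Bool) (T : BinaryTree Unit) :
    (leaves s T).length = T.numNodes + 1 := by
  induction T generalizing s with
  | nil => rfl
  | node a l r ihl ihr => rw [leaves, List.length_append, ihl, ihr, BinaryTree.numNodes]; omega

/-- The leaf between two consecutive nodes is oriented to the left if and only if the first node is
an ancestor of the second one. -/
theorem getElem?_leaves (s : Bool) (m : ℕ) (T : BinaryTree Unit) (i : ℕ) (hi : 1 ≤ i)
    (hi' : i < T.numNodes) :
    ((leaves s T)[i]? = some true ∧ Anc m T (m + i) (m + i + 1)) ∨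
      ((leaves s T)[i]? = some false ∧ Anc m T (m + i + 1) (m + i)) := by
  induction T generalizing s m i with
  | nil => simp at hi'
  | node a l r ihl ihr =>
    rw [BinaryTree.numNodes] at hi'
    rw [leaves]
    -- Leaf `i`, counted from 0, separates the nodes `m + i` and `m + i + 1`. In the middle case it
    -- is the last leaf of the left subtree, just before the root.
    rcases lt_trichotomy i l.numNodes with h | h | h
    · rw [List.getElem?_append_left (by rw [length_leaves]; omega)]
      rcases ihl true m i hi h with h1 | h1
      · exact .inl ⟨h1.1, .inr (.inl h1.2)⟩
      · exact .inr ⟨h1.1, .inr (.inl h1.2)⟩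
    · rw [List.getElem?_append_left (by rw [length_leaves]; omega)]
      refine .inr ⟨?_, .inl (by omega)⟩
      -- The bound `1 ≤ i` excludes an empty left subtree, whose only leaf would be a left child.
      cases l with
      | nil => simp at h; omega
      | node b l' r' =>
        have h1 := length_leaves true (.node b l' r')
        rw [leaves_node, ← List.cons_append] at h1 ⊢
        rw [List.length_append, List.length_singleton] at h1
        rw [h, List.getElem?_append_right (by omega),
          show (BinaryTree.node b l' r').numNodes -
            (true :: canopy (BinaryTree.node b l' r')).length = 0 by omega]
        rfl
    · rw [List.getElem?_append_right (by rw [length_leaves]; omega), length_leaves]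
      rcases eq_or_lt_of_le (Nat.succ_le_of_lt h) with h2 | h2
      · refine .inl ⟨?_, .inl (by omega)⟩
        cases r with
        | nil => simp at hi'; omega
        | node b l' r' => rw [leaves_node, ← h2]; simp
      · have h3 := ihr false (m + l.numNodes + 1) (i - (l.numNodes + 1)) (by omega) (by omega)
        rw [show m + l.numNodes + 1 + (i - (l.numNodes + 1)) = m + i by omega] at h3
        rcases h3 with h1 | h1
        · exact .inl ⟨h1.1, .inr (.inr h1.2)⟩
        · exact .inr ⟨h1.1, .inr (.inr h1.2)⟩

theorem length_canopy (T : BinaryTree Unit) : (canopy T).length = T.numNodes - 1 := by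
  rw [canopy, List.length_dropLast, List.length_tail, length_leaves]
  omega

/-- The canopy omits the first leaf, so its position `i` is leaf `i + 1`, between the nodes `i + 1`
and `i + 2`. -/
theorem canopy_getElem (T : BinaryTree Unit) (i : ℕ) (hi : i < (canopy T).length) :
    ((canopy T)[i] = true ∧ Anc 0 T (i + 1) (i + 2)) ∨
      ((canopy T)[i] = false ∧ Anc 0 T (i + 2) (i + 1)) := by
  have hl := length_canopy T
  have h := getElem?_leaves true 0 T (i + 1) (by omega) (by omega)
  have h2 : (leaves true T)[i + 1]? = some (canopy T)[i] := by
    rw [← List.getElem?_eq_getElem]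
    cases T with
    | nil => rw [hl] at hi; simp at hi
    | node a l r =>
      rw [leaves_node, List.getElem?_cons_succ, List.getElem?_append_left hi]
  rw [h2] at h
  simpa only [Option.some.injEq, Nat.zero_add, Nat.add_assoc] using h

/-- Complementary canopies in terms of ancestors. -/
theorem isTwin_iff (A B : BinaryTree Unit) :
    IsTwin (A, B) ↔ A.numNodes = B.numNodes ∧
      ∀ i, ¬ (Anc 0 A (i + 1) (i + 2) ∧ Anc 0 B (i + 1) (i + 2)) ∧
        ¬ (Anc 0 A (i + 2) (i + 1) ∧ Anc 0 B (i + 2) (i + 1)) := by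
  unfold IsTwin
  rw [List.forall₂_iff_get]
  have hA := length_canopy A
  have hB := length_canopy B
  constructor
  · rintro ⟨h1, h2, h3⟩
    refine ⟨h1, fun i => ?_⟩
    simp only at h2 h3
    by_cases hi : i < (canopy A).length
    · have h4 := h3 i hi (h2 ▸ hi)
      simp only [List.get_eq_getElem] at h4
      have n1 : ∀ T, ¬ (Anc 0 T (i + 1) (i + 2) ∧ Anc 0 T (i + 2) (i + 1)) := fun T h => by
        have := h.1.antisymm h.2
        omega
      have nA := n1 A
      have nB := n1 B
      rcases canopy_getElem A i hi with ⟨h5, h6⟩ | ⟨h5, h6⟩ <;>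
        rcases canopy_getElem B i (h2 ▸ hi) with ⟨h7, h8⟩ | ⟨h7, h8⟩ <;>
        first | (exact absurd (h5.trans h7.symm) h4) | tauto
    · constructor <;> rintro ⟨h, _⟩ <;> have := h.bounds <;> omega
  · rintro ⟨h1, h2⟩
    simp only at h1 ⊢
    refine ⟨h1, by omega, fun i hi hi' => ?_⟩
    simp only [List.get_eq_getElem]
    have h2 := h2 i
    rcases canopy_getElem A i hi with ⟨h5, h6⟩ | ⟨h5, h6⟩ <;>
      rcases canopy_getElem B i hi' with ⟨h7, h8⟩ | ⟨h7, h8⟩ <;>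
      rw [h5, h7] <;> first | (exfalso; tauto) | simp

/-- A tree can be cut anywhere along its right branch; the size of the upper part determines the
cut. -/
theorem treeUnder_cancel {A A' C C' : BinaryTree Unit} (h : A.numNodes = A'.numNodes)
    (h' : treeUnder A C = treeUnder A' C') : A = A' ∧ C = C' := by
  induction A generalizing A' with
  | nil =>
    rw [eq_nil_of_numNodes_eq_zero h.symm] at h' ⊢
    exact ⟨rfl, h'⟩
  | node a l r _ ih =>
    cases A' with
    | nil => simp at h
    | node b l' r' =>
      simp only [treeUnder, BinaryTree.node.injEq] at h'
      obtain ⟨_, rfl, h2⟩ := h'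
      rw [BinaryTree.numNodes, BinaryTree.numNodes] at h
      obtain ⟨rfl, rfl⟩ := ih (by omega) h2
      exact ⟨rfl, rfl⟩

theorem treeOver_cancel {A A' C C' : BinaryTree Unit} (h : C.numNodes = C'.numNodes)
    (h' : treeOver A C = treeOver A' C') : A = A' ∧ C = C' := by
  induction C generalizing C' with
  | nil =>
    rw [eq_nil_of_numNodes_eq_zero h.symm] at h' ⊢
    exact ⟨h', rfl⟩
  | node a l r ih _ =>
    cases C' with
    | nil => simp at h
    | node b l' r' =>
      simp only [treeOver, BinaryTree.node.injEq] at h'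
      obtain ⟨_, h2, rfl⟩ := h'
      rw [BinaryTree.numNodes, BinaryTree.numNodes] at h
      obtain ⟨rfl, rfl⟩ := ih (by omega) h2
      exact ⟨rfl, rfl⟩

/-! ### Ancestors in binary search trees of words -/

/-- The word `w` is a rearrangement of `m + 1, …, m + |w|`. -/
def IsIntervalWord (m : ℕ) (w : List ℕ) : Prop := w.Nodup ∧ ∀ i, i ∈ w ↔ m < i ∧ i ≤ m + w.length

theorem IsPermWord.isIntervalWord {w : List ℕ} (h : IsPermWord w) : IsIntervalWord 0 w :=
  ⟨h.nodup, fun i => by rw [h.mem_iff]; omega⟩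

theorem IsIntervalWord.reverse {m : ℕ} {w : List ℕ} (h : IsIntervalWord m w) :
    IsIntervalWord m w.reverse :=
  ⟨List.nodup_reverse.2 h.1, fun i => by rw [List.mem_reverse, h.2, List.length_reverse]⟩

/-- The letters of `w` below `a` are exactly $m+1,\dots,a-1$, so the rank of the root is read off
the size of the left subtree. -/
theorem IsIntervalWord.of_cons {m a : ℕ} {w : List ℕ} (h : IsIntervalWord m (a :: w)) :
    a = m + (w.filter (· < a)).length + 1 ∧ IsIntervalWord m (w.filter (· < a)) ∧
      IsIntervalWord a (w.filter (¬ · < a)) := by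
  have hnd := h.1
  rw [List.nodup_cons] at hnd
  have ha := (h.2 a).1 (by simp)
  have hmem : ∀ i, i ∈ w ↔ (m < i ∧ i ≤ m + (w.length + 1)) ∧ i ≠ a := by
    intro i
    have := h.2 i
    rw [List.mem_cons, List.length_cons] at this
    by_cases hia : i = a
    · subst hia; simp [hnd.1]
    · rw [← this]; simp [hia]
  have hl : (w.filter (· < a)).length = a - (m + 1) := by
    have hp : (w.filter (· < a)).toFinset = Finset.Ico (m + 1) a := by
      ext i
      simp only [List.mem_toFinset, List.mem_filter, hmem, decide_eq_true_eq, Finset.mem_Ico]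
      rw [List.length_cons] at ha
      omega
    rw [← List.toFinset_card_of_nodup (hnd.2.filter _), hp, Nat.card_Ico]
  have hadd := length_filter_lt_add a w
  rw [List.length_cons] at ha
  refine ⟨by omega, ⟨hnd.2.filter _, fun i => ?_⟩, ⟨hnd.2.filter _, fun i => ?_⟩⟩
  · rw [List.mem_filter, hmem, hl, decide_eq_true_eq]
    omega
  · rw [List.mem_filter, hmem, decide_eq_true_eq]
    omega

/-- In the binary search tree of a word, `i` is an ancestor of `j` if and only if `i` occurs in the
word before all the letters between `i` and `j`. -/
theorem anc_bst_iff (w : List ℕ) (m : ℕ) (hw : IsIntervalWord m w) (i j : ℕ) :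
    Anc m (bst w) i j ↔ i ∈ w ∧ j ∈ w ∧
      ∀ k, min i j ≤ k → k ≤ max i j → k ≠ i → Bef w i k := by
  induction w using bst_induction generalizing m with
  | nil => simp [bst_nil, Anc]
  | cons a w h1 h2 =>
    obtain ⟨ha, hw1, hw2⟩ := hw.of_cons
    have hadd := length_filter_lt_add a w
    rw [bst_cons, Anc, numNodes_bst, numNodes_bst, ← ha, h1 m hw1, h2 a hw2]
    have hmem := hw.2
    have hnd := List.nodup_cons.1 hw.1
    simp only [List.length_cons] at hmem
    have hwmem : ∀ k, k ∈ w ↔ (m < k ∧ k ≤ m + (w.length + 1)) ∧ k ≠ a := by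
      intro k
      have := hmem k
      rw [List.mem_cons] at this
      by_cases hia : k = a
      · subst hia; simp [hnd.1]
      · rw [← this]; simp [hia]
    have hab := (hmem a).1 (by simp)
    simp only [bef_filter, List.mem_filter, decide_eq_true_eq, bef_cons]
    constructor
    · rintro (⟨rfl, h3, h4⟩ | ⟨⟨h3, h4⟩, ⟨h5, h6⟩, h7⟩ | ⟨⟨h3, h4⟩, ⟨h5, h6⟩, h7⟩)
      · refine ⟨by simp, (hmem j).2 (by omega), fun k hk hk' hne => .inl ⟨rfl, ?_⟩⟩
        rw [hwmem]
        omega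
      · exact ⟨by simp [h3], by simp [h5], fun k hk hk' hne => .inr (h7 k hk hk' hne).1⟩
      · exact ⟨by simp [h3], by simp [h5], fun k hk hk' hne => .inr (h7 k hk hk' hne).1⟩
    · rintro ⟨h3, h4, h5⟩
      have h3' := (hmem i).1 h3
      have h4' := (hmem j).1 h4
      by_cases hia : i = a
      · left; omega
      -- If the root `a` lay between `i` and `j`, then `i` would have to precede the first letter.
      -- So `i` and `j` are on the same side of `a`, and the induction applies to that subtree.
      · have hnb : ¬ (min i j ≤ a ∧ a ≤ max i j) := by
          rintro ⟨h6, h7⟩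
          rcases h5 a h6 h7 (Ne.symm hia) with ⟨h8, _⟩ | h8
          · exact hia h8
          · exact hnd.1 h8.mem.2
        right
        rcases lt_or_gt_of_ne hia with hlt | hgt
        · left
          refine ⟨⟨(hwmem i).2 (by omega), hlt⟩, ⟨(hwmem j).2 (by omega), by omega⟩, ?_⟩
          intro k hk hk' hne
          exact ⟨(h5 k hk hk' hne).resolve_left (fun h => hia h.1), hlt, by omega⟩
        · right
          refine ⟨⟨(hwmem i).2 (by omega), by omega⟩, ⟨(hwmem j).2 (by omega), by omega⟩, ?_⟩
          intro k hk hk' hne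
          exact ⟨(h5 k hk hk' hne).resolve_left (fun h => hia h.1), by omega, by omega⟩

/-- A word in which ancestors come before their descendants has the given tree as its binary search
tree. -/
theorem bst_eq_of_anc (T : BinaryTree Unit) (m : ℕ) (w : List ℕ) (hw : IsIntervalWord m w)
    (hl : w.length = T.numNodes) (h : ∀ i j, Anc m T i j → i ≠ j → Bef w i j) : bst w = T := by
  induction T generalizing m w with
  | nil => rw [List.length_eq_zero_iff.1 hl]; rfl
  | node c l r ihl ihr =>
    rw [BinaryTree.numNodes] at hl
    cases w with
    | nil => simp at hl
    | cons a w =>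
      obtain ⟨ha, hw1, hw2⟩ := hw.of_cons
      have hadd := length_filter_lt_add a w
      have hnd := List.nodup_cons.1 hw.1
      have ha' := (hw.2 a).1 (by simp)
      rw [List.length_cons] at hl ha'
      -- The root of the tree is an ancestor of every node, hence must be the first letter.
      have hroot : a = m + l.numNodes + 1 := by
        by_contra hne
        have h1 := h (m + l.numNodes + 1) a (.inl (by omega)) (Ne.symm hne)
        rw [bef_cons] at h1
        rcases h1 with ⟨h2, _⟩ | h1
        · exact hne h2.symm
        · exact hnd.1 h1.mem.2
      rw [bst_cons]
      simp only [Anc, ← hroot] at h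
      congr 1
      · refine ihl m _ hw1 (by omega) fun i j hij hne => ?_
        have hb := hij.bounds
        have h1 := h i j (.inr (.inl hij)) hne
        rw [bef_cons] at h1
        rw [bef_filter, decide_eq_true_eq, decide_eq_true_eq]
        exact ⟨h1.resolve_left (by omega), by omega, by omega⟩
      · refine ihr a _ hw2 (by omega) fun i j hij hne => ?_
        have hb := hij.bounds
        have h1 := h i j (.inr (.inr hij)) hne
        rw [bef_cons] at h1
        rw [bef_filter, decide_eq_true_eq, decide_eq_true_eq]
        exact ⟨h1.resolve_left (by omega), by omega, by omega⟩

/-- If the same one of two consecutive letters were the ancestor in both trees, it would precede the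
other both in `σ` and in its mirror image. -/
theorem isTwin_pShape (σ : PermWord) : IsTwin (pShape σ) := by
  have hi := σ.2.isIntervalWord
  rw [pShape_eq, isTwin_iff]
  refine ⟨by simp [numNodes_bst], fun i => ⟨?_, ?_⟩⟩ <;>
  · rw [anc_bst_iff _ 0 hi, anc_bst_iff _ 0 hi.reverse]
    rintro ⟨⟨_, _, h1⟩, ⟨_, _, h2⟩⟩
    first
    | exact (h1 (i + 2) (by omega) (by omega) (by omega)).asymm hi.1
        ((bef_reverse _ _ _).1 (h2 (i + 2) (by omega) (by omega) (by omega)))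
    | exact (h1 (i + 1) (by omega) (by omega) (by omega)).asymm hi.1
        ((bef_reverse _ _ _).1 (h2 (i + 1) (by omega) (by omega) (by omega)))

/-! ### The minimal permutation of a Baxter class -/

/-- The inversion `c ⋯ a` (with `a < c`) is imposed by an arc of one of the two trees. -/
def Forced (J : TwinPair) (c a : ℕ) : Prop := a < c ∧ (Anc 0 J.1.1 c a ∨ Anc 0 J.1.2 a c)

/-- The inversions of the minimal permutation of the class of `J`. -/
def MinInv (J : TwinPair) : ℕ → ℕ → Prop := Relation.TransGen (Forced J)

theorem MinInv.lt {J : TwinPair} {c a : ℕ} (h : MinInv J c a) : a < c := by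
  induction h with
  | single h => exact h.1
  | tail _ h ih => exact h.1.trans ih

/-- By `Anc.between`, an arc of the left tree from `c` down to `a` also dominates `b` from `c`, and
an arc of the right tree from `a` to `c` dominates `b` from `a`. -/
theorem Forced.split {J : TwinPair} {c b a : ℕ} (h : Forced J c a) (hab : a < b) (hbc : b < c) :
    Forced J c b ∨ Forced J b a := by
  rcases h with ⟨_, h | h⟩
  · exact .inl ⟨hbc, .inl (h.between (by omega) (by omega))⟩
  · exact .inr ⟨hab, .inr (h.between (by omega) (by omega))⟩

/-- Co-transitivity survives the transitive closure: either the chain from `c` to `a` passes through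
`b`, or the link jumping over `b` is split by `Forced.split`. Transitivity and co-transitivity
together characterize inversion sets. -/
theorem MinInv.split {J : TwinPair} {c b a : ℕ} (h : MinInv J c a) (hab : a < b) (hbc : b < c) :
    MinInv J c b ∨ MinInv J b a := by
  induction h with
  | single h => exact (h.split hab hbc).imp .single .single
  | @tail d a h h' ih =>
    rcases lt_trichotomy d b with hdb | rfl | hdb
    · exact (ih hdb).imp id fun h1 => h1.tail h'
    · exact .inl h
    · exact (h'.split hab hdb).imp (fun h1 => h.tail h1) .single

/-- The total order on letters which defines the minimal permutation of the class of `J`. -/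
def MinOrder (J : TwinPair) (i j : ℕ) : Prop := (i ≤ j ∧ ¬ MinInv J j i) ∨ MinInv J i j

theorem minOrder_total (J : TwinPair) (i j : ℕ) : MinOrder J i j ∨ MinOrder J j i := by
  unfold MinOrder
  have := le_total i j
  tauto

/-- Transitivity of `MinInv` and `MinInv.split` (the transitivity of non-inversions) are both
needed, according to which of the two steps are inversions. -/
theorem MinOrder.trans {J : TwinPair} {i j k : ℕ} (h : MinOrder J i j) (h' : MinOrder J j k) :
    MinOrder J i k := by
  rcases h with ⟨h1, h2⟩ | h1 <;> rcases h' with ⟨h3, h4⟩ | h3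
  · refine .inl ⟨h1.trans h3, fun h5 => ?_⟩
    rcases eq_or_lt_of_le h1 with rfl | h1
    · exact h4 h5
    rcases eq_or_lt_of_le h3 with rfl | h3
    · exact h2 h5
    exact (h5.split h1 h3).elim h4 h2
  · have := h3.lt
    rcases le_or_gt i k with hik | hik
    · exact .inl ⟨hik, fun h5 => h2 (h3.trans h5)⟩
    rcases eq_or_lt_of_le h1 with rfl | h1
    · exact .inr h3
    exact .inr ((h3.split hik h1).resolve_left h2)
  · have := h1.lt
    rcases le_or_gt i k with hik | hik
    · exact .inl ⟨hik, fun h5 => h4 (h5.trans h1)⟩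
    rcases eq_or_lt_of_le h3 with rfl | h3
    · exact .inr h1
    exact .inr ((h1.split h3 hik).resolve_right h4)
  · exact .inr (h1.trans h3)

open scoped Classical in
/-- The minimal permutation with `P`-symbol `J`. -/
noncomputable def minPerm (J : TwinPair) : PermWord :=
  ⟨(List.range' 1 J.size).insertionSort (MinOrder J), by
    unfold IsPermWord
    rw [List.length_insertionSort, List.length_range']
    exact List.perm_insertionSort _ _⟩

theorem size_minPerm (J : TwinPair) : (minPerm J).size = J.size := by
  simp [minPerm, PermWord.size, List.length_insertionSort]

theorem minOrder_of_bef {J : TwinPair} {i j : ℕ} (h : Bef (minPerm J).1 i j) : MinOrder J i j := by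
  classical
  have : Std.Total (MinOrder J) := ⟨minOrder_total J⟩
  have : IsTrans ℕ (MinOrder J) := ⟨fun _ _ _ => MinOrder.trans⟩
  have hp := List.pairwise_insertionSort (MinOrder J) (List.range' 1 J.size)
  rw [List.pairwise_iff_forall_sublist] at hp
  refine hp (Eq.mp ?_ h)
  unfold Bef minPerm
  congr!

theorem minInv_iff {J : TwinPair} {a c : ℕ} (h : a < c) :
    Bef (minPerm J).1 c a ↔ MinInv J c a := by
  constructor
  · intro hb
    exact (minOrder_of_bef hb).resolve_left fun h' => by omega
  · intro hq
    have hn := (minPerm J).2.nodup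
    have hs : (minPerm J).1.length = J.size := size_minPerm J
    have hJ : J.1.1.numNodes = J.1.2.numNodes := J.2.1
    have hmem : ∀ {c a}, Forced J c a → c ∈ (minPerm J).1 ∧ a ∈ (minPerm J).1 := by
      intro c a hf
      rw [(minPerm J).2.mem_iff, (minPerm J).2.mem_iff, hs]
      unfold TwinPair.size
      rcases hf with ⟨_, hf | hf⟩ <;> have := hf.bounds <;> omega
    -- The ends of a chain belong to forced arcs, hence are labels of nodes.
    have hca : c ∈ (minPerm J).1 ∧ a ∈ (minPerm J).1 := by
      obtain ⟨d, h1, _⟩ := Relation.TransGen.tail'_iff.1 hq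
      obtain ⟨d', h2, _⟩ := Relation.TransGen.head'_iff.1 hq
      exact ⟨(hmem h2).1, (hmem ‹Forced J d a›).2⟩
    refine (bef_or_bef hca.1 hca.2 h.ne').resolve_right fun hb => ?_
    rcases minOrder_of_bef hb with h1 | h1
    · exact h1.2 hq
    · exact absurd h1.lt (by omega)

theorem TwinPair.not_anc {J : TwinPair} (i : ℕ) :
    ¬ (Anc 0 J.1.1 (i + 1) (i + 2) ∧ Anc 0 J.1.2 (i + 1) (i + 2)) ∧
      ¬ (Anc 0 J.1.1 (i + 2) (i + 1) ∧ Anc 0 J.1.2 (i + 2) (i + 1)) :=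
  ((isTwin_iff _ _).1 J.2).2 i

/-- The point is that the closure adds no forbidden inversion. If $i<j$ were inverted, the last link
of the chain would force some $y$ before $i$, with $i<y\le j$, and $i$ is an ancestor of $y$ in the
left tree. A left arc from $y$ to $i$ contradicts antisymmetry; a right arc from $i$ to $y$ puts $i$
above $i+1$ in both trees, against the twin condition. -/
theorem anc_left_bef_minPerm {J : TwinPair} {i j : ℕ} (h : Anc 0 J.1.1 i j) (hij : i ≠ j) :
    Bef (minPerm J).1 i j := by
  rcases lt_or_gt_of_ne hij with hlt | hlt
  · have hb := h.bounds
    have hs : (minPerm J).1.length = J.1.1.numNodes := size_minPerm J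
    refine (bef_or_bef ((minPerm J).2.mem_iff.2 (by omega)) ((minPerm J).2.mem_iff.2 (by omega))
      hij).resolve_right fun hb => ?_
    rw [minInv_iff hlt] at hb
    obtain ⟨y, hy, hf⟩ := Relation.TransGen.tail'_iff.1 hb
    have hyj : y ≤ j := by
      rcases Relation.reflTransGen_iff_eq_or_transGen.1 hy with rfl | hy
      · rfl
      · exact (MinInv.lt hy).le
    obtain ⟨hiy, hf⟩ := hf
    have h1 : Anc 0 J.1.1 i y := h.between (by omega) (by omega)
    rcases hf with hf | hf
    · exact hiy.ne (h1.antisymm hf)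
    · obtain ⟨i, rfl⟩ : ∃ k, i = k + 1 := ⟨i - 1, by omega⟩
      exact (TwinPair.not_anc i).1
        ⟨h1.between (by omega) (by omega), hf.between (by omega) (by omega)⟩
  · exact (minInv_iff hlt).2 (.single ⟨hlt, .inl h⟩)

theorem anc_right_bef_minPerm {J : TwinPair} {i j : ℕ} (h : Anc 0 J.1.2 i j) (hij : i ≠ j) :
    Bef (minPerm J).1 j i := by
  rcases lt_or_gt_of_ne hij with hlt | hlt
  · exact (minInv_iff hlt).2 (.single ⟨hlt, .inr h⟩)
  · have hb := h.bounds
    have hs : (minPerm J).1.length = J.1.1.numNodes := size_minPerm J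
    have hJ : J.1.1.numNodes = J.1.2.numNodes := J.2.1
    refine (bef_or_bef ((minPerm J).2.mem_iff.2 (by omega)) ((minPerm J).2.mem_iff.2 (by omega))
      hij).resolve_left fun hb => ?_
    rw [minInv_iff hlt] at hb
    -- Mirror image of the previous argument: the first link of the chain is examined instead of the
    -- last.
    obtain ⟨y, hf, hy⟩ := Relation.TransGen.head'_iff.1 hb
    have hyj : j ≤ y := by
      rcases Relation.reflTransGen_iff_eq_or_transGen.1 hy with rfl | hy
      · rfl
      · exact (MinInv.lt hy).le
    obtain ⟨hiy, hf⟩ := hf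
    have h1 : Anc 0 J.1.2 i y := h.between (by omega) (by omega)
    rcases hf with hf | hf
    · obtain ⟨i, rfl⟩ : ∃ k, i = k + 2 := ⟨i - 2, by omega⟩
      exact (TwinPair.not_anc i).2
        ⟨hf.between (by omega) (by omega), h1.between (by omega) (by omega)⟩
    · exact hiy.ne (hf.antisymm h1)

theorem pShape_minPerm (J : TwinPair) : pShape (minPerm J) = J.1 := by
  have hi := (minPerm J).2.isIntervalWord
  have hs : (minPerm J).1.length = J.1.1.numNodes := size_minPerm J
  have hJ : J.1.1.numNodes = J.1.2.numNodes := J.2.1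
  rw [pShape_eq]
  refine Prod.ext ?_ ?_
  · exact bst_eq_of_anc _ 0 _ hi hs fun i j h hij => anc_left_bef_minPerm h hij
  · refine bst_eq_of_anc _ 0 _ hi.reverse (by rw [List.length_reverse, hs, hJ]) fun i j h hij => ?_
    rw [bef_reverse]
    exact anc_right_bef_minPerm h hij

theorem size_eq_of_pShape {σ : PermWord} {J : TwinPair} (h : pShape σ = J.1) :
    σ.size = J.size := by
  rw [TwinPair.size, ← h, pShape_eq, numNodes_bst, PermWord.size]

/-- A forced arc of `σ` means that one letter is inverted with all those between it and the other
end. These inversions persist in `ν`, so the arc is present in the trees of `ν`, which are those of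
`ν'`. Allowing three permutations yields at once minimality in the class and compatibility of the
order with the classes. -/
theorem minPerm_le {J : TwinPair} {σ ν ν' : PermWord} (hσ : pShape σ = J.1)
    (h : PermWord.Le σ ν) (hν : pShape ν = pShape ν') : PermWord.Le (minPerm J) ν' := by
  rw [PermWord.le_iff] at h ⊢
  have hs : ν.size = ν'.size :=
    (size_eq_of_pShape (J := ⟨pShape ν', isTwin_pShape ν'⟩) hν).trans (size_eq_of_pShape rfl).symm
  refine ⟨by rw [size_minPerm, ← size_eq_of_pShape hσ, h.1, hs], fun a c hac hb => ?_⟩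
  rw [minInv_iff hac] at hb
  have hi := σ.2.isIntervalWord
  have hn := ν.2.isIntervalWord
  have hn' := ν'.2.isIntervalWord
  have hp := σ.2.perm ν.2 h.1
  have key : ∀ {c a}, Forced J c a → Bef ν'.1 c a := by
    rintro c a ⟨hac, hf⟩
    rw [← hσ, pShape_eq] at hf
    rw [pShape_eq, pShape_eq, Prod.mk.injEq] at hν
    rcases hf with hf | hf
    · have h1 := (anc_bst_iff _ 0 hi _ _).1 hf
      have h2 : Anc 0 (bst ν.1) c a := by
        rw [anc_bst_iff _ 0 hn, ← hp.mem_iff, ← hp.mem_iff]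
        exact ⟨h1.1, h1.2.1, fun k hk hk' hne =>
          h.2 k c (by omega) (h1.2.2 k hk hk' hne)⟩
      rw [hν.1, anc_bst_iff _ 0 hn'] at h2
      exact h2.2.2 a (by omega) (by omega) (by omega)
    · have h1 := (anc_bst_iff _ 0 hi.reverse _ _).1 hf
      have h2 : Anc 0 (bst ν.1.reverse) a c := by
        rw [anc_bst_iff _ 0 hn.reverse]
        simp only [List.mem_reverse, bef_reverse] at h1 ⊢
        rw [← hp.mem_iff, ← hp.mem_iff]
        exact ⟨h1.1, h1.2.1, fun k hk hk' hne =>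
          h.2 a k (by omega) (h1.2.2 k hk hk' hne)⟩
      rw [hν.2, anc_bst_iff _ 0 hn'.reverse] at h2
      exact (bef_reverse _ _ _).1 (h2.2.2 c (by omega) (by omega) (by omega))
  clear hac
  induction hb with
  | single hf => exact key hf
  | tail _ hf ih => exact ih.trans ν'.2.nodup (key hf)

/-- The pair of twin binary trees of a permutation. -/
def twinOf (σ : PermWord) : TwinPair := ⟨pShape σ, isTwin_pShape σ⟩

theorem twinOf_eq_iff {σ : PermWord} {J : TwinPair} : twinOf σ = J ↔ pShape σ = J.1 :=
  Subtype.ext_iff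

theorem twinOf_minPerm (J : TwinPair) : twinOf (minPerm J) = J := Subtype.ext (pShape_minPerm J)

theorem size_twinOf (σ : PermWord) : (twinOf σ).size = σ.size := (size_eq_of_pShape rfl).symm

theorem twinOf_slash (σ ν : PermWord) :
    twinOf (PermWord.slash σ ν) = (twinOf σ).slash (twinOf ν) :=
  Subtype.ext (pShape_slash σ ν)

/-- The existential definition of the Baxter order is replaced by a comparison with one canonical
permutation. This makes it a partial order and its up-sets unions of classes forming principal
up-sets of the permutohedron. -/
theorem le_twinOf_iff {J : TwinPair} {ν : PermWord} :
    TwinPair.Le J (twinOf ν) ↔ PermWord.Le (minPerm J) ν := by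
  constructor
  · rintro ⟨σ, ν', h, hσ, hν⟩
    exact minPerm_le hσ h hν
  · intro h
    exact ⟨_, ν, h, pShape_minPerm J, rfl⟩

theorem TwinPair.le_iff {J J' : TwinPair} :
    TwinPair.Le J J' ↔ PermWord.Le (minPerm J) (minPerm J') := by
  rw [← le_twinOf_iff, twinOf_minPerm]

theorem minPerm_injective : Function.Injective minPerm := fun J J' h => by
  rw [← twinOf_minPerm J, h, twinOf_minPerm]

/-! ### Factorizations of permutations -/

theorem filter_le_append_filter {n : ℕ} {w : List ℕ}
    (h : ∀ i j, i ≤ n → n < j → ¬ Bef w j i) :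
    w = w.filter (· ≤ n) ++ w.filter (¬ · ≤ n) := by
  induction w with
  | nil => rfl
  | cons a w ih =>
    have ih := ih fun i j hi hj hb => h i j hi hj ((bef_cons _ _ _ _).2 (.inr hb))
    by_cases ha : a ≤ n
    · rw [List.filter_cons_of_pos (by simpa using ha), List.filter_cons_of_neg (by simpa using ha),
        List.cons_append, ← ih]
    · have hw : ∀ i ∈ w, ¬ i ≤ n := fun i hi hin =>
        h i a hin (by omega) ((bef_cons _ _ _ _).2 (.inl ⟨rfl, hi⟩))
      rw [List.filter_cons_of_neg (by simpa using ha), List.filter_cons_of_pos (by simpa using ha),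
        List.filter_eq_nil_iff.2 (by simpa using hw), List.filter_eq_self.2 (by simpa using hw),
        List.nil_append]

theorem IsPermWord.filter_le {w : List ℕ} (hw : IsPermWord w) {n : ℕ} (hn : n ≤ w.length) :
    (w.filter (· ≤ n)).length = n ∧ IsPermWord (w.filter (· ≤ n)) := by
  have hp : (w.filter (· ≤ n)).Perm (List.range' 1 n) := by
    rw [List.perm_ext_iff_of_nodup (hw.nodup.filter _) (List.nodup_range' ..)]
    intro i
    rw [List.mem_filter, hw.mem_iff, List.mem_range'_1, decide_eq_true_eq]
    omega
  have hl : (w.filter (· ≤ n)).length = n := by simpa using hp.length_eq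
  refine ⟨hl, ?_⟩
  unfold IsPermWord
  rwa [hl]

theorem bef_slash_shift {σ ν : PermWord} {i j : ℕ} :
    Bef (PermWord.slash σ ν).1 i j ↔
      Bef σ.1 i j ∨ (σ.1.length ≤ i ∧ σ.1.length ≤ j ∧ Bef ν.1 (i - σ.1.length) (j - σ.1.length)) ∨
        (i ∈ σ.1 ∧ j ∈ shift σ.1.length ν.1) := by
  rw [PermWord.slash, bef_append]
  refine or_congr_right (or_congr_left ?_)
  constructor
  · intro h
    have h1 := mem_shift.1 h.mem.1
    have h2 := mem_shift.1 h.mem.2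
    refine ⟨h1.1, h2.1, ?_⟩
    rw [← bef_shift σ.1.length]
    rwa [Nat.sub_add_cancel h1.1, Nat.sub_add_cancel h2.1]
  · rintro ⟨h1, h2, h⟩
    rw [← bef_shift σ.1.length] at h
    rwa [Nat.sub_add_cancel h1, Nat.sub_add_cancel h2] at h

/-- The inversions of `σ ╱ ν`. -/
theorem bef_slash {σ ν : PermWord} {i j : ℕ} (hij : i < j) :
    Bef (PermWord.slash σ ν).1 j i ↔
      Bef σ.1 j i ∨ (σ.1.length ≤ i ∧ Bef ν.1 (j - σ.1.length) (i - σ.1.length)) := by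
  rw [bef_slash_shift]
  constructor
  · rintro (h | ⟨_, h1, h2⟩ | ⟨h1, h2⟩)
    · exact .inl h
    · exact .inr ⟨h1, h2⟩
    · have := lt_of_mem_of_mem_shift σ.2 ν.2 _ h1 _ h2
      omega
  · rintro (h | ⟨h1, h2⟩)
    · exact .inl h
    · exact .inr (.inl ⟨by omega, h1, h2⟩)

/-- In $\sigma\diagup\nu$ no inversion involves one letter up to $|\sigma|$ and one beyond it; the
same then holds below, so the small letters come first. -/
theorem PermWord.exists_slash_of_le {τ σ ν : PermWord} (h : PermWord.Le τ (PermWord.slash σ ν)) :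
    ∃ σ' ν', τ = PermWord.slash σ' ν' ∧ σ'.size = σ.size ∧ ν'.size = ν.size := by
  rw [PermWord.le_iff, PermWord.size_slash] at h
  have hs : ∀ i j, i ≤ σ.1.length → σ.1.length < j → ¬ Bef τ.1 j i := by
    intro i j hi hj hb
    have h1 := (bef_slash (by omega)).1 (h.2 i j (by omega) hb)
    rcases h1 with h1 | ⟨h1, h2⟩
    · have := (σ.2.mem_iff.1 h1.mem.1).2
      omega
    · have := (ν.2.mem_iff.1 h2.mem.2).1
      omega
  have hf := filter_le_append_filter hs
  have hlen : σ.1.length ≤ τ.1.length := by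
    have := h.1
    simp only [PermWord.size] at this
    omega
  obtain ⟨hl, hp⟩ := τ.2.filter_le hlen
  obtain ⟨ν', h1, h2⟩ := PermWord.exists_eq_slash (σ := ⟨_, hp⟩) hf
  refine ⟨_, ν', h1, hl, ?_⟩
  have h3 := h.1
  rw [h1, PermWord.size_slash] at h3
  have : PermWord.size ⟨τ.1.filter (· ≤ σ.1.length), hp⟩ = σ.size := hl
  omega

theorem PermWord.slash_le_slash {σ σ' ν ν' : PermWord} (h : PermWord.Le σ σ')
    (h' : PermWord.Le ν ν') : PermWord.Le (PermWord.slash σ ν) (PermWord.slash σ' ν') := by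
  rw [PermWord.le_iff] at h h' ⊢
  refine ⟨by rw [PermWord.size_slash, PermWord.size_slash, h.1, h'.1], fun i j hij => ?_⟩
  rw [bef_slash hij, bef_slash hij]
  have hl : σ.1.length = σ'.1.length := h.1
  rw [← hl]
  refine Or.imp (h.2 i j hij) fun ⟨h1, h2⟩ => ⟨h1, h'.2 _ _ (by omega) h2⟩

theorem TwinPair.slash_cancel {J₀ J₁ J₀' J₁' : TwinPair} (h : J₀.size = J₀'.size)
    (h' : J₀.slash J₁ = J₀'.slash J₁') : J₀ = J₀' ∧ J₁ = J₁' := by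
  have h1 : J₀.1.1.numNodes = J₀'.1.1.numNodes := h
  have e := Subtype.ext_iff.1 h'
  simp only [TwinPair.slash, Prod.mk.injEq] at e
  have h2 := treeUnder_cancel h1 e.1
  have h3 : J₁.1.2.numNodes = J₁'.1.2.numNodes := by
    have a1 : J₁.1.1.numNodes = J₁.1.2.numNodes := J₁.2.1
    have a2 : J₁'.1.1.numNodes = J₁'.1.2.numNodes := J₁'.2.1
    rw [← a1, ← a2, h2.2]
  have h4 := treeOver_cancel h3 e.2
  exact ⟨Subtype.ext (Prod.ext h2.1 h4.1), Subtype.ext (Prod.ext h2.2 h4.2)⟩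

theorem TwinPair.size_slash (J₀ J₁ : TwinPair) : (J₀.slash J₁).size = J₀.size + J₁.size :=
  numNodes_treeUnder _ _

/-- The concatenation of the minima lies in the right class, hence above the minimum. The minimum,
being below it, also splits as a concatenation; cancellation in twin pairs identifies the classes of
its factors, which are thus above the respective minima. -/
theorem minPerm_slash (J₀ J₁ : TwinPair) :
    minPerm (J₀.slash J₁) = PermWord.slash (minPerm J₀) (minPerm J₁) := by
  have h1 : twinOf (PermWord.slash (minPerm J₀) (minPerm J₁)) = J₀.slash J₁ := by
    rw [twinOf_slash, twinOf_minPerm, twinOf_minPerm]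
  have hle : PermWord.Le (minPerm (J₀.slash J₁)) (PermWord.slash (minPerm J₀) (minPerm J₁)) :=
    minPerm_le (twinOf_eq_iff.1 h1) .refl rfl
  refine hle.antisymm ?_
  obtain ⟨σ, ν, h2, h3, h4⟩ := PermWord.exists_slash_of_le hle
  have h5 : (twinOf σ).slash (twinOf ν) = J₀.slash J₁ := by
    rw [← twinOf_slash, ← h2, twinOf_minPerm]
  obtain ⟨h6, h7⟩ := TwinPair.slash_cancel (by rw [size_twinOf, h3, size_minPerm]) h5
  rw [h2]
  exact PermWord.slash_le_slash (minPerm_le (twinOf_eq_iff.1 h6) .refl rfl)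
    (minPerm_le (twinOf_eq_iff.1 h7) .refl rfl)

/-! ### Shuffles -/

/-- When `p` separates the two alphabets, a shuffle determines its two factors, recovered by
filtering. -/
theorem mem_shuffle_iff (p : ℕ → Bool) {u v : List ℕ} (hu : ∀ i ∈ u, p i = true)
    (hv : ∀ i ∈ v, p i = false) (w : List ℕ) :
    w ∈ shuffle u v ↔ w.filter p = u ∧ w.filter (fun i => !p i) = v := by
  induction w generalizing u v with
  | nil =>
    constructor
    · intro h
      have := (perm_of_mem_shuffle u v _ h).symm
      rw [List.perm_nil, List.append_eq_nil_iff] at this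
      rw [this.1, this.2]
      exact ⟨rfl, rfl⟩
    · rintro ⟨rfl, rfl⟩
      simp [shuffle_nil_left]
  | cons c w ih =>
    cases u with
    | nil =>
      rw [shuffle_nil_left, Multiset.mem_singleton]
      constructor
      · rintro rfl
        rw [List.filter_eq_nil_iff, List.filter_eq_self]
        exact ⟨fun i hi => by simp [hv i hi], fun i hi => by simp [hv i hi]⟩
      · rintro ⟨h1, h2⟩
        rw [List.filter_eq_nil_iff] at h1
        rw [← h2, List.filter_eq_self.2]
        intro i hi
        simpa using h1 i hi
    | cons a u =>
      cases v with
      | nil =>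
        rw [shuffle_nil_right, Multiset.mem_singleton]
        constructor
        · intro h
          rw [h, List.filter_eq_nil_iff, List.filter_eq_self]
          exact ⟨fun i hi => by simp [hu i hi], fun i hi => by simp [hu i hi]⟩
        · rintro ⟨h1, h2⟩
          rw [List.filter_eq_nil_iff] at h2
          rw [← h1, List.filter_eq_self.2]
          intro i hi
          simpa using h2 i hi
      | cons b v =>
        have ha := hu a (by simp)
        have hb := hv b (by simp)
        have hu' : ∀ i ∈ u, p i = true := fun i hi => hu i (List.mem_cons_of_mem _ hi)
        have hv' : ∀ i ∈ v, p i = false := fun i hi => hv i (List.mem_cons_of_mem _ hi)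
        have h1 := ih hu' hv
        have h2 := ih hu hv'
        rw [shuffle_cons_cons, Multiset.mem_add, Multiset.mem_map, Multiset.mem_map]
        have e1 : (∃ x ∈ shuffle u (b :: v), a :: x = c :: w) ↔ a = c ∧ w ∈ shuffle u (b :: v) := by
          simp only [List.cons.injEq]
          constructor
          · rintro ⟨x, hx, h, rfl⟩
            exact ⟨h, hx⟩
          · rintro ⟨h, hx⟩
            exact ⟨w, hx, h, rfl⟩
        have e2 : (∃ x ∈ shuffle (a :: u) v, b :: x = c :: w) ↔
            b = c ∧ w ∈ shuffle (a :: u) v := by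
          simp only [List.cons.injEq]
          constructor
          · rintro ⟨x, hx, h, rfl⟩
            exact ⟨h, hx⟩
          · rintro ⟨h, hx⟩
            exact ⟨w, hx, h, rfl⟩
        rw [e1, e2, h1, h2]
        cases hc : p c
        · rw [List.filter_cons_of_neg (by simp [hc]), List.filter_cons_of_pos (by simp [hc]),
            List.cons.injEq]
          have : a ≠ c := by rintro rfl; rw [ha] at hc; simp at hc
          simp only [this, false_and, false_or]
          rw [and_left_comm, @eq_comm _ b c]
        · rw [List.filter_cons_of_pos (by simp [hc]), List.filter_cons_of_neg (by simp [hc]),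
            List.cons.injEq]
          have : b ≠ c := by rintro rfl; rw [hb] at hc; simp at hc
          simp only [this, false_and, or_false]
          rw [and_assoc, @eq_comm _ a c]

theorem nodup_shuffle {u v : List ℕ} (h : ∀ i ∈ u, i ∉ v) : (shuffle u v).Nodup := by
  induction u generalizing v with
  | nil => simp [shuffle_nil_left]
  | cons a u ihu =>
    induction v with
    | nil => simp [shuffle_nil_right]
    | cons b v ihv =>
      rw [shuffle_cons_cons, Multiset.nodup_add]
      refine ⟨(ihu fun i hi => h i (List.mem_cons_of_mem _ hi)).map List.cons_injective,
        (ihv fun i hi hi' => h i hi (List.mem_cons_of_mem _ hi')).map List.cons_injective, ?_⟩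
      rw [Multiset.disjoint_left]
      intro w hw hw'
      obtain ⟨x, _, rfl⟩ := Multiset.mem_map.1 hw
      obtain ⟨y, _, hy⟩ := Multiset.mem_map.1 hw'
      rw [List.cons.injEq] at hy
      exact h a (by simp) (by simp [hy.1])

namespace PermWord

theorem mem_shiftedShuffle {σ ν π : PermWord} :
    π ∈ shiftedShuffle σ ν ↔ π.1.filter (· ≤ σ.1.length) = σ.1 ∧
      π.1.filter (¬ · ≤ σ.1.length) = shift σ.1.length ν.1 := by
  have h := mem_shuffle_iff (fun i => decide (i ≤ σ.1.length)) (u := σ.1)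
    (v := shift σ.1.length ν.1)
    (fun i hi => by simpa using (σ.2.mem_iff.1 hi).2)
    (fun i hi => by
      rw [mem_shift, ν.2.mem_iff] at hi
      simp only [decide_eq_false_iff_not]
      omega) π.1
  simp only [decide_not, ← h, shiftedShuffle, Multiset.mem_pmap]
  constructor
  · rintro ⟨w, hw, rfl⟩
    exact hw
  · exact fun hw => ⟨π.1, hw, rfl⟩

theorem nodup_shiftedShuffle (σ ν : PermWord) : (shiftedShuffle σ ν).Nodup := by
  refine Multiset.Nodup.pmap (fun a _ b _ h => congrArg Subtype.val h) (nodup_shuffle ?_)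
  intro i hi hi'
  exact (lt_of_mem_of_mem_shift σ.2 ν.2 i hi i hi').false

theorem shift_injective (m : ℕ) : Function.Injective (shift m) :=
  List.map_injective_iff.2 (add_left_injective m)

theorem size_of_mem_shiftedShuffle {σ ν π : PermWord} (h : π ∈ shiftedShuffle σ ν) :
    π.size = σ.size + ν.size := by
  rw [mem_shiftedShuffle] at h
  have := List.length_eq_length_filter_add (l := π.1) (fun x => decide (x ≤ σ.1.length))
  simp only [decide_not] at h
  rw [h.1, h.2] at this
  simpa [size, shift] using this

/-- Being above $\sigma\diagup\nu$ constrains only inversions among small letters and inversions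
among large letters, never those between the two groups. So `α` and `β` are the restrictions of `π`
to each group, and the way they are shuffled is free. -/
theorem slash_le_iff {σ ν π : PermWord} :
    Le (slash σ ν) π ↔ ∃ α β, Le σ α ∧ Le ν β ∧ π ∈ shiftedShuffle α β := by
  constructor
  · intro h
    rw [le_iff, size_slash] at h
    have hlen : σ.1.length ≤ π.1.length := by
      have := h.1
      simp only [size] at this
      omega
    obtain ⟨hl, hp⟩ := π.2.filter_le hlen
    have hperm : (π.1.filter (· ≤ σ.1.length) ++ π.1.filter (¬ · ≤ σ.1.length)).Perm π.1 := by
      simpa only [decide_not] using List.filter_append_perm (fun x => decide (x ≤ σ.1.length)) π.1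
    -- Standardizes the large letters, by applying the splitting lemma to the small letters followed
    -- by the large ones.
    obtain ⟨β, hβ, hβs⟩ := exists_eq_slash (σ := ⟨_, hp⟩) (w := ⟨_, IsPermWord.of_perm hperm π.2⟩)
      rfl
    have hβ' : π.1.filter (¬ · ≤ σ.1.length) = shift σ.1.length β.1 := by
      have := congrArg Subtype.val hβ
      simp only [slash, hl] at this
      exact List.append_cancel_left this
    have hβl : β.1.length = ν.1.length := by
      have h1 := hperm.length_eq
      have h2 := h.1
      rw [List.length_append, hl, ← hβs] at h1
      simp only [size] at h1 h2
      omega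
    refine ⟨⟨_, hp⟩, β, le_iff.2 ⟨hl.symm, fun i j hij hb => ?_⟩,
      le_iff.2 ⟨hβl.symm, fun i j hij hb => ?_⟩, ?_⟩
    · have h1 := h.2 i j hij ((bef_slash hij).2 (.inl hb))
      have h2 := (σ.2.mem_iff.1 hb.mem.1).2
      have h3 := (σ.2.mem_iff.1 hb.mem.2).2
      exact (bef_filter _ _ _ _).2 ⟨h1, by simpa using h2, by simpa using h3⟩
    · have h1 := h.2 (i + σ.1.length) (j + σ.1.length) (by omega)
        ((bef_slash (by omega)).2 (.inr ⟨by omega, by simpa using hb⟩))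
      have h2 := (ν.2.mem_iff.1 hb.mem.1).1
      have h3 := (ν.2.mem_iff.1 hb.mem.2).1
      rw [← bef_shift σ.1.length, ← hβ', bef_filter]
      exact ⟨h1, by simp; omega, by simp; omega⟩
    · rw [mem_shiftedShuffle]
      simp only [hl]
      exact ⟨trivial, hβ'⟩
  · rintro ⟨α, β, hα, hβ, hπ⟩
    have hs := size_of_mem_shiftedShuffle hπ
    rw [mem_shiftedShuffle] at hπ
    rw [le_iff] at hα hβ ⊢
    refine ⟨by rw [size_slash, hs, hα.1, hβ.1], fun i j hij hb => ?_⟩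
    have hl : σ.1.length = α.1.length := hα.1
    rw [bef_slash hij] at hb
    rcases hb with hb | ⟨h1, hb⟩
    · have h2 := hα.2 i j hij hb
      rw [← hπ.1] at h2
      exact ((bef_filter _ _ _ _).1 h2).1
    · have h2 := hβ.2 _ _ (by omega) hb
      rw [← bef_shift α.1.length, ← hπ.2, bef_filter, hl, Nat.sub_add_cancel (by omega),
        Nat.sub_add_cancel (by omega)] at h2
      exact h2.1

end PermWord

/-! ### Multiplicativity -/

variable {K : Type*}

open scoped Classical in
/-- The set of permutations above `σ` in the permutohedron order. -/
noncomputable def upSet (σ : PermWord) : Finset PermWord :=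
  {ν ∈ PermWord.ofSize σ.size | PermWord.Le σ ν}

theorem mem_upSet {σ ν : PermWord} : ν ∈ upSet σ ↔ PermWord.Le σ ν := by
  classical
  rw [upSet, Finset.mem_filter, PermWord.mem_ofSize]
  exact ⟨fun h => h.2, fun h => ⟨h.size_eq.symm, h⟩⟩

/-- An equality of multisets, so that it transfers to sums: different pairs `(α, β)` have disjoint
shuffles, since both factors are recovered by filtering. -/
theorem upSet_slash (σ ν : PermWord) :
    (upSet (PermWord.slash σ ν)).1 = ((upSet σ).1.bind fun α => (upSet ν).1.bind fun β =>
      PermWord.shiftedShuffle α β) := by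
  rw [Multiset.Nodup.ext (upSet _).2]
  · intro π
    simp only [Multiset.mem_bind, Finset.mem_val, mem_upSet, PermWord.slash_le_iff]
    constructor
    · rintro ⟨α, β, hα, hβ, h⟩
      exact ⟨α, hα, β, hβ, h⟩
    · rintro ⟨α, hα, β, hβ, h⟩
      exact ⟨α, β, hα, hβ, h⟩
  · rw [Multiset.nodup_bind]
    refine ⟨fun α _ => Multiset.nodup_bind.2 ⟨fun β _ => PermWord.nodup_shiftedShuffle α β, ?_⟩, ?_⟩
    · refine ((upSet ν).2.pairwise ?_)
      intro β _ β' _ hne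
      rw [Function.onFun, Multiset.disjoint_left]
      intro π h h'
      rw [PermWord.mem_shiftedShuffle] at h h'
      exact hne (Subtype.ext (PermWord.shift_injective _ (h.2.symm.trans h'.2)))
    · refine ((upSet σ).2.pairwise ?_)
      intro α hα α' hα' hne
      rw [Function.onFun, Multiset.disjoint_left]
      intro π h h'
      obtain ⟨β, _, h⟩ := Multiset.mem_bind.1 h
      obtain ⟨β', _, h'⟩ := Multiset.mem_bind.1 h'
      have hl : α.1.length = α'.1.length :=
        ((mem_upSet (σ := σ)).1 hα).size_eq.symm.trans ((mem_upSet (σ := σ)).1 hα').size_eq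
      rw [PermWord.mem_shiftedShuffle] at h h'
      rw [← hl] at h'
      exact hne (Subtype.ext (h.1.symm.trans h'.1))

theorem sum_upSet_mul [CommRing K] (σ ν : PermWord) :
    (∑ α ∈ upSet σ, FQSym.F K α) * (∑ β ∈ upSet ν, FQSym.F K β) =
      ∑ π ∈ upSet (PermWord.slash σ ν), FQSym.F K π := by
  rw [Finset.sum_mul_sum]
  simp only [FQSym.F_mul_F, FQSym.prodF]
  simp only [Finset.sum, upSet_slash, Multiset.map_bind, Multiset.sum_bind]

theorem TwinPair.mem_ofSize {n : ℕ} {J : TwinPair} : J ∈ TwinPair.ofSize n ↔ J.size = n := by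
  have h : J.1.1.numNodes = J.1.2.numNodes := J.2.1
  simp only [TwinPair.ofSize, Finset.mem_subtype, Finset.mem_product,
    BinaryTree.mem_treesOfNumNodesEq, TwinPair.size]
  omega

theorem TwinPair.Le.size_eq {J J' : TwinPair} (h : TwinPair.Le J J') : J.size = J'.size := by
  rw [← size_minPerm, ← size_minPerm]
  exact (TwinPair.le_iff.1 h).size_eq

/-- Grouping the permutations above `minPerm J` by class, `le_twinOf_iff` shows that each class is
taken entirely or not at all. -/
theorem E_eq [CommRing K] (J : TwinPair) : E K J = ∑ ν ∈ upSet (minPerm J), FQSym.F K ν := by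
  classical
  rw [E, ← Finset.sum_fiberwise_of_maps_to (g := twinOf)
    (t := {J' ∈ TwinPair.ofSize J.size | TwinPair.Le J J'})]
  · refine Finset.sum_congr (by congr!) fun J' hJ' => ?_
    rw [Finset.mem_filter] at hJ'
    rw [P]
    refine Finset.sum_congr (Finset.ext fun ν => ?_) fun _ _ => rfl
    rw [Finset.mem_filter, Finset.mem_filter, PermWord.mem_ofSize, mem_upSet, twinOf_eq_iff,
      ← le_twinOf_iff]
    constructor
    · rintro ⟨_, h⟩
      exact ⟨by rw [twinOf_eq_iff.2 h]; exact hJ'.2, h⟩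
    · rintro ⟨_, h⟩
      exact ⟨size_eq_of_pShape h, h⟩
  · intro ν hν
    rw [mem_upSet, ← le_twinOf_iff] at hν
    rw [Finset.mem_filter, TwinPair.mem_ofSize]
    exact ⟨hν.size_eq.symm, hν⟩

theorem E_mul_E [CommRing K] (J₀ J₁ : TwinPair) : E K J₀ * E K J₁ = E K (J₀.slash J₁) := by
  rw [E_eq, E_eq, E_eq, minPerm_slash, sum_upSet_mul]

/-- The empty pair of twin binary trees. -/
def TwinPair.empty : TwinPair := ⟨(.nil, .nil), rfl, by simp [canopy, leaves]⟩

theorem TwinPair.eq_empty {J : TwinPair} (h : J.size = 0) : J = TwinPair.empty := by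
  have h' : J.1.1.numNodes = J.1.2.numNodes := J.2.1
  exact Subtype.ext (Prod.ext (eq_nil_of_numNodes_eq_zero h)
    (eq_nil_of_numNodes_eq_zero (h'.symm.trans h)))

theorem PermWord.eq_empty {σ : PermWord} (h : σ.size = 0) : σ = PermWord.empty :=
  Subtype.ext (List.length_eq_zero_iff.1 h)

theorem E_empty [CommRing K] : E K TwinPair.empty = 1 := by
  rw [E_eq, FQSym.one_def, ← Finset.sum_singleton (FQSym.F K) PermWord.empty]
  refine Finset.sum_congr (Finset.ext fun ν => ?_) fun _ _ => rfl
  have hm : minPerm TwinPair.empty = PermWord.empty := PermWord.eq_empty (size_minPerm _)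
  rw [mem_upSet, hm, Finset.mem_singleton]
  constructor
  · intro h
    exact PermWord.eq_empty h.size_eq.symm
  · rintro rfl
    exact .refl

/-! ### Linear bases -/

theorem TwinPair.Le.refl (J : TwinPair) : TwinPair.Le J J := TwinPair.le_iff.2 .refl

theorem TwinPair.Le.trans {J J' J'' : TwinPair} (h : TwinPair.Le J J') (h' : TwinPair.Le J' J'') :
    TwinPair.Le J J'' := by
  rw [TwinPair.le_iff] at *
  exact Relation.ReflTransGen.trans h h'

theorem TwinPair.Le.antisymm {J J' : TwinPair} (h : TwinPair.Le J J') (h' : TwinPair.Le J' J) :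
    J = J' := by
  rw [TwinPair.le_iff] at *
  exact minPerm_injective (PermWord.Le.antisymm h h')

open scoped Classical in
/-- The set of pairs of twin binary trees above `J` in the Baxter order. -/
noncomputable def TwinPair.upSet (J : TwinPair) : Finset TwinPair :=
  {J' ∈ TwinPair.ofSize J.size | TwinPair.Le J J'}

theorem TwinPair.mem_upSet {J J' : TwinPair} : J' ∈ J.upSet ↔ TwinPair.Le J J' := by
  classical
  rw [TwinPair.upSet, Finset.mem_filter, TwinPair.mem_ofSize]
  exact ⟨fun h => h.2, fun h => ⟨h.size_eq.symm, h⟩⟩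

theorem TwinPair.card_upSet_lt {J J' : TwinPair} (h : TwinPair.Le J J') (hne : J ≠ J') :
    J'.upSet.card < J.upSet.card := by
  refine Finset.card_lt_card (Finset.ssubset_iff_of_subset ?_ |>.2 ⟨J, ?_, ?_⟩)
  · intro x
    rw [TwinPair.mem_upSet, TwinPair.mem_upSet]
    exact h.trans
  · rw [TwinPair.mem_upSet]
    exact .refl J
  · rw [TwinPair.mem_upSet]
    exact fun h' => hne (h.antisymm h')

/-- Inversion of a unitriangular system, by induction on the size of the up-set. -/
theorem P_mem_span_E [CommRing K] (J : TwinPair) : P K J ∈ Submodule.span K (Set.range (E K)) := by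
  classical
  induction hn : J.upSet.card using Nat.strong_induction_on generalizing J with
  | _ n ih =>
    subst hn
    have h : E K J = P K J + ∑ J' ∈ J.upSet.erase J, P K J' := by
      rw [Finset.add_sum_erase _ _ (TwinPair.mem_upSet.2 (.refl J)), E, TwinPair.upSet]
    rw [← sub_eq_iff_eq_add] at h
    rw [← h]
    refine Submodule.sub_mem _ (Submodule.subset_span ⟨J, rfl⟩) (Submodule.sum_mem _ ?_)
    intro J' hJ'
    rw [Finset.mem_erase, TwinPair.mem_upSet] at hJ'
    exact ih _ (TwinPair.card_upSet_lt hJ'.2 hJ'.1.symm) J' rfl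

theorem span_E_eq_span_P [CommRing K] :
    Submodule.span K (Set.range (E K)) = Submodule.span K (Set.range (P K)) := by
  apply le_antisymm
  · rw [Submodule.span_le]
    rintro _ ⟨J, rfl⟩
    exact Submodule.sum_mem _ fun J' _ => Submodule.subset_span ⟨J', rfl⟩
  · rw [Submodule.span_le]
    rintro _ ⟨J, rfl⟩
    exact P_mem_span_E J

theorem coord_E [CommRing K] (J J' : TwinPair) :
    (FQSym.F K).repr (E K J) (minPerm J') = if J' ∈ J.upSet then 1 else 0 := by
  classical
  rw [E_eq, map_sum, Finsupp.finsetSum_apply]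
  simp only [Module.Basis.repr_self, Finsupp.single_apply]
  rw [Finset.sum_ite_eq']
  simp only [mem_upSet, TwinPair.mem_upSet, TwinPair.le_iff]

theorem linearIndependent_E [Field K] : LinearIndependent K (E K) := by
  classical
  rw [linearIndependent_iff']
  intro s c hc J hJ
  by_contra hne
  -- An element of the support with the largest up-set is minimal in the support, so no other term
  -- contributes to the coordinate at `minPerm J₀`.
  obtain ⟨J₀, h₀, hmax⟩ := (s.filter fun J => c J ≠ 0).exists_max_image (fun J => J.upSet.card)
    ⟨J, Finset.mem_filter.2 ⟨hJ, hne⟩⟩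
  rw [Finset.mem_filter] at h₀
  have h := congrArg (fun x => (FQSym.F K).repr x (minPerm J₀)) hc
  simp only [map_sum, Finsupp.finsetSum_apply, map_smul, Finsupp.smul_apply, coord_E, map_zero,
    Finsupp.zero_apply, smul_eq_mul] at h
  rw [Finset.sum_eq_single J₀] at h
  · rw [if_pos (TwinPair.mem_upSet.2 (.refl _)), mul_one] at h
    exact h₀.2 h
  · intro J' hJ' hne'
    by_cases hle : J₀ ∈ J'.upSet
    · by_cases hz : c J' = 0
      · rw [hz, zero_mul]
      · have h1 := hmax J' (Finset.mem_filter.2 ⟨hJ', hz⟩)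
        have h2 := TwinPair.card_upSet_lt (TwinPair.mem_upSet.1 hle) hne'
        omega
    · rw [if_neg hle, mul_zero]
  · exact fun h' => absurd h₀.1 h'

theorem toSubmodule_Baxter [CommRing K] :
    Subalgebra.toSubmodule (Baxter K) = Submodule.span K (Set.range (P K)) := by
  apply le_antisymm
  · rw [← span_E_eq_span_P]
    have h1 : (1 : FQSym K) ∈ Submodule.span K (Set.range (E K)) :=
      Submodule.subset_span ⟨TwinPair.empty, E_empty⟩
    have hmul : ∀ x y, x ∈ Submodule.span K (Set.range (E K)) →
        y ∈ Submodule.span K (Set.range (E K)) → x * y ∈ Submodule.span K (Set.range (E K)) := by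
      intro x y hx hy
      have h := Submodule.mul_mem_mul hx hy
      rw [Submodule.span_mul_span] at h
      refine Submodule.span_mono ?_ h
      rintro _ ⟨_, ⟨J₀, rfl⟩, _, ⟨J₁, rfl⟩, rfl⟩
      exact ⟨J₀.slash J₁, (E_mul_E J₀ J₁).symm⟩
    have hle : Baxter K ≤ (Submodule.span K (Set.range (E K))).toSubalgebra h1 hmul := by
      rw [Baxter, Algebra.adjoin_le_iff]
      rintro _ ⟨J, rfl⟩
      exact P_mem_span_E J
    exact hle
  · exact Algebra.span_le_adjoin K _

/-! ### Unique factorization -/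

theorem TwinPair.exists_pShape (J : TwinPair) : ∃ σ, pShape σ = J.1 := ⟨_, pShape_minPerm J⟩

theorem TwinPair.IsConnected.size_pos {J : TwinPair} (h : J.IsConnected) : 0 < J.size := by
  obtain ⟨σ, hσ⟩ := J.exists_pShape
  rw [← size_eq_of_pShape hσ]
  exact Nat.pos_of_ne_zero fun h0 => (h σ hσ).1 (PermWord.eq_empty h0)

theorem TwinPair.slash_assoc (J₀ J₁ J₂ : TwinPair) :
    (J₀.slash J₁).slash J₂ = J₀.slash (J₁.slash J₂) := by
  have hu : ∀ A B C : BinaryTree Unit,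
      treeUnder (treeUnder A B) C = treeUnder A (treeUnder B C) := by
    intro A B C
    induction A with
    | nil => rfl
    | node a l r _ ih => simp only [treeUnder, ih]
  have ho : ∀ A B C : BinaryTree Unit,
      treeOver (treeOver A B) C = treeOver A (treeOver B C) := by
    intro A B C
    induction C with
    | nil => rfl
    | node a l r ih _ => simp only [treeOver, ih]
  exact Subtype.ext (Prod.ext (hu _ _ _) (ho _ _ _))

theorem TwinPair.empty_slash (J : TwinPair) : TwinPair.empty.slash J = J :=
  Subtype.ext (Prod.ext rfl (treeOver_nil _))

theorem TwinPair.slash_empty (J : TwinPair) : J.slash TwinPair.empty = J :=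
  Subtype.ext (Prod.ext (treeUnder_nil _) rfl)

theorem foldr_slash_append (l l' : List TwinPair) :
    (l ++ l').foldr TwinPair.slash TwinPair.empty =
      (l.foldr TwinPair.slash TwinPair.empty).slash (l'.foldr TwinPair.slash TwinPair.empty) := by
  induction l with
  | nil => exact (TwinPair.empty_slash _).symm
  | cons J l ih => rw [List.cons_append, List.foldr_cons, ih, List.foldr_cons, TwinPair.slash_assoc]

/-- If `J` is not connected, a single decomposable permutation of its class suffices: the classes of
its two factors are strictly smaller and multiply to `J`. -/
theorem TwinPair.exists_factorization (J : TwinPair) :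
    ∃ l : List {J : TwinPair // J.IsConnected},
      (l.map Subtype.val).foldr TwinPair.slash TwinPair.empty = J := by
  induction hn : J.size using Nat.strong_induction_on generalizing J with
  | _ n ih =>
    subst hn
    by_cases h0 : J.size = 0
    · exact ⟨[], (TwinPair.eq_empty h0).symm⟩
    by_cases hc : J.IsConnected
    · exact ⟨[⟨J, hc⟩], TwinPair.slash_empty J⟩
    · unfold TwinPair.IsConnected at hc
      push Not at hc
      obtain ⟨σ, hσ, hnc⟩ := hc
      have hs := size_eq_of_pShape hσ
      have hne : σ ≠ PermWord.empty := by
        rintro rfl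
        exact h0 hs.symm
      unfold PermWord.IsConnected at hnc
      push Not at hnc
      obtain ⟨ν, π, rfl, hν, hπ⟩ := hnc hne
      have hsz := PermWord.size_slash ν π
      have hν0 : ν.size ≠ 0 := by
        intro h
        rw [PermWord.eq_empty h] at hπ
        exact hπ (Subtype.ext (by simp [PermWord.slash, PermWord.empty, shift]))
      have hπ0 : π.size ≠ 0 := by
        intro h
        rw [PermWord.eq_empty h] at hν
        exact hν (Subtype.ext (by simp [PermWord.slash, PermWord.empty, shift]))
      obtain ⟨l, hl⟩ := ih _ (by rw [size_twinOf]; omega) (twinOf ν) rfl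
      obtain ⟨l', hl'⟩ := ih _ (by rw [size_twinOf]; omega) (twinOf π) rfl
      refine ⟨l ++ l', ?_⟩
      rw [List.map_append, foldr_slash_append, hl, hl', ← twinOf_slash, twinOf_eq_iff, hσ]

/-- Otherwise `minPerm J` would be a proper nonempty prefix of `minPerm J'`, by `minPerm_slash`, and
would split off a factor of a connected permutation. -/
theorem TwinPair.IsConnected.size_le {J J' R R' : TwinPair} (h : J'.IsConnected) (hJ : 0 < J.size)
    (heq : J.slash R = J'.slash R') : J'.size ≤ J.size := by
  by_contra hlt
  have hm := congrArg (fun J => (minPerm J).1) heq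
  simp only [minPerm_slash] at hm
  have hl : (minPerm J).1.length = J.size := size_minPerm J
  have hl' : (minPerm J').1.length = J'.size := size_minPerm J'
  have hpre : (minPerm J).1 <+: (minPerm J').1 := by
    exact List.prefix_of_prefix_length_le ⟨shift (minPerm J).1.length (minPerm R).1, rfl⟩
      ⟨shift (minPerm J').1.length (minPerm R').1, hm.symm⟩ (by omega)
  obtain ⟨x, hx⟩ := hpre
  obtain ⟨ν, hν, hνs⟩ := PermWord.exists_eq_slash hx.symm
  have hsz := congrArg PermWord.size hν
  rw [PermWord.size_slash, size_minPerm, size_minPerm] at hsz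
  rcases (h _ (pShape_minPerm J')).2 _ _ hν with h1 | h1
  · have := congrArg PermWord.size h1
    rw [size_minPerm, size_minPerm] at this
    omega
  · have := congrArg PermWord.size h1
    rw [size_minPerm] at this
    omega

theorem bijective_foldr_slash :
    Function.Bijective fun l : List {J : TwinPair // J.IsConnected} =>
      (l.map Subtype.val).foldr TwinPair.slash TwinPair.empty := by
  refine ⟨fun l l' h => ?_, TwinPair.exists_factorization⟩
  dsimp only at h
  have hne : ∀ (J : {J : TwinPair // J.IsConnected}) R, J.1.slash R ≠ TwinPair.empty := by
    intro J R h
    have h1 := congrArg TwinPair.size h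
    have h2 := J.2.size_pos
    rw [TwinPair.size_slash] at h1
    have h3 : TwinPair.size TwinPair.empty = 0 := rfl
    omega
  induction l generalizing l' with
  | nil =>
    cases l' with
    | nil => rfl
    | cons J' l' => exact absurd h.symm (hne J' _)
  | cons J l ih =>
    cases l' with
    | nil => exact absurd h (hne J _)
    | cons J' l' =>
      rw [List.map_cons, List.map_cons, List.foldr_cons, List.foldr_cons] at h
      obtain ⟨h1, h2⟩ := TwinPair.slash_cancel (le_antisymm (J.2.size_le J'.2.size_pos h.symm)
        (J'.2.size_le J.2.size_pos h)) h
      rw [Subtype.ext h1, ih _ h2]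

/-! ### Freeness from a multiplicative basis -/

/-- The monomials of the free algebra are sent bijectively onto the basis `b`, so the lift coincides
with a linear equivalence. -/
theorem bijective_lift_of_basis {R A ι : Type*} [CommRing R] [Ring A] [Algebra R A]
    (b : Module.Basis ι R A) (op : ι → ι → ι) (e : ι) (p : ι → Prop) (he : b e = 1)
    (hop : ∀ i j, b i * b j = b (op i j))
    (hp : Function.Bijective fun l : List {i // p i} => (l.map Subtype.val).foldr op e) :
    Function.Bijective (FreeAlgebra.lift R fun i : {i // p i} => b i.1) := by
  have hl : ∀ l : List {i // p i}, (l.map fun i => b i.1).prod =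
      b ((l.map Subtype.val).foldr op e) := by
    intro l
    induction l with
    | nil => exact he.symm
    | cons i l ih => rw [List.map_cons, List.prod_cons, ih, hop]; rfl
  let c := FreeAlgebra.basisFreeMonoid R {i // p i}
  let eqv : FreeMonoid {i // p i} ≃ ι := FreeMonoid.toList.trans (Equiv.ofBijective _ hp)
  have h : (FreeAlgebra.lift R fun i : {i // p i} => b i.1).toLinearMap =
      (c.equiv b eqv).toLinearMap := by
    refine c.ext fun w => ?_
    rw [LinearEquiv.coe_coe, Module.Basis.equiv_apply, AlgHom.toLinearMap_apply]
    have hw : c w = (w.toList.map (FreeAlgebra.ι R)).prod := by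
      simp [c, FreeAlgebra.basisFreeMonoid, FreeAlgebra.equivMonoidAlgebraFreeMonoid,
        FreeMonoid.lift_apply]
    rw [hw, map_list_prod, List.map_map]
    simp only [Function.comp_def, FreeAlgebra.lift_ι_apply]
    exact hl _
  have hf : ⇑(FreeAlgebra.lift R fun i : {i // p i} => b i.1) = c.equiv b eqv :=
    funext fun x => LinearMap.congr_fun h x
  rw [hf]
  exact (c.equiv b eqv).bijective

theorem bijective_lift_Baxter {K : Type*} [Field K] (X : TwinPair → FQSym K)
    (hX : ∀ J, X J ∈ Baxter K) (hli : LinearIndependent K X)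
    (hspan : Submodule.span K (Set.range X) = Subalgebra.toSubmodule (Baxter K))
    (op : TwinPair → TwinPair → TwinPair) (e : TwinPair) (p : TwinPair → Prop) (he : X e = 1)
    (hop : ∀ i j, X i * X j = X (op i j))
    (hp : Function.Bijective fun l : List {i // p i} => (l.map Subtype.val).foldr op e) :
    Function.Bijective (FreeAlgebra.lift K
      fun J : {J // p J} => (⟨X J.1, hX J.1⟩ : Baxter K)) := by
  let v : TwinPair → Baxter K := fun J => ⟨X J, hX J⟩
  have hv : LinearIndependent K v :=
    LinearIndependent.of_comp (Baxter K).val.toLinearMap hli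
  have hs : ⊤ ≤ Submodule.span K (Set.range v) := by
    intro x _
    have hx : (x : FQSym K) ∈ Submodule.span K (Set.range X) := by
      rw [hspan]
      exact x.2
    have hr : Set.range X = (Baxter K).val.toLinearMap '' Set.range v := by
      rw [← Set.range_comp]
      rfl
    rw [hr, Submodule.span_image] at hx
    obtain ⟨y, hy, hyx⟩ := hx
    rwa [← Subtype.ext (a1 := y) (a2 := x) hyx]
  have hb : ∀ J, Module.Basis.mk hv hs J = v J := Module.Basis.mk_apply hv hs
  have := bijective_lift_of_basis (Module.Basis.mk hv hs) op e p
    (by rw [hb]; exact Subtype.ext he) (by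
      intro i j
      rw [hb, hb, hb]
      exact Subtype.ext (hop i j)) hp
  simpa only [hb] using this

/-! ### The mirror automorphism -/

/-- Membership in a shifted shuffle is expressed by filtering, which commutes with reversal; absence
of multiplicities does the rest. -/
theorem PermWord.shiftedShuffle_mirror (σ ν : PermWord) :
    PermWord.shiftedShuffle (PermWord.mirror σ) (PermWord.mirror ν) =
      (PermWord.shiftedShuffle σ ν).map PermWord.mirror := by
  have hinj : Function.Injective PermWord.mirror :=
    Function.LeftInverse.injective PermWord.mirror_mirror
  rw [Multiset.Nodup.ext (PermWord.nodup_shiftedShuffle _ _)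
    ((PermWord.nodup_shiftedShuffle _ _).map hinj)]
  intro π
  have h : ∀ π, π ∈ PermWord.shiftedShuffle (PermWord.mirror σ) (PermWord.mirror ν) ↔
      PermWord.mirror π ∈ PermWord.shiftedShuffle σ ν := by
    intro π
    rw [PermWord.mem_shiftedShuffle, PermWord.mem_shiftedShuffle]
    simp only [PermWord.mirror, List.length_reverse, List.filter_reverse]
    have hs : shift σ.1.length ν.1.reverse = (shift σ.1.length ν.1).reverse := List.map_reverse
    rw [hs, List.reverse_eq_iff (as := List.filter _ π.1), List.reverse_eq_iff]
  rw [h, Multiset.mem_map]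
  constructor
  · intro h
    exact ⟨_, h, PermWord.mirror_mirror π⟩
  · rintro ⟨π, h, rfl⟩
    rwa [PermWord.mirror_mirror]

/-- The mirror image, as a permutation of the set of permutations. -/
def PermWord.mirrorEquiv : PermWord ≃ PermWord :=
  ⟨PermWord.mirror, PermWord.mirror, PermWord.mirror_mirror, PermWord.mirror_mirror⟩

/-- The automorphism of `FQSym` sending `F_σ` to `F_{σ'}` for `σ'` the mirror image of `σ`. -/
noncomputable def FQSym.mirror (K : Type*) [CommRing K] : FQSym K ≃ₐ[K] FQSym K :=
  AlgEquiv.ofLinearEquiv ((FQSym.F K).equiv (FQSym.F K) PermWord.mirrorEquiv)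
    (by
      rw [FQSym.one_def, Module.Basis.equiv_apply]
      rfl)
    (by
      set f := (FQSym.F K).equiv (FQSym.F K) PermWord.mirrorEquiv with hf
      have hF : ∀ σ, f (FQSym.F K σ) = FQSym.F K (PermWord.mirror σ) := fun σ =>
        Module.Basis.equiv_apply ..
      intro x y
      induction x using FQSym.induction_F with
      | zero => simp
      | add x₁ x₂ h₁ h₂ => rw [add_mul, map_add, map_add, h₁, h₂, add_mul]
      | smul c x h => rw [smul_mul_assoc, map_smul, map_smul, h, smul_mul_assoc]
      | basis σ =>
        induction y using FQSym.induction_F with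
        | zero => simp
        | add x₁ x₂ h₁ h₂ => rw [mul_add, map_add, map_add, h₁, h₂, mul_add]
        | smul c x h => rw [mul_smul_comm, map_smul, map_smul, h, mul_smul_comm]
        | basis ν =>
          rw [hF, hF, FQSym.F_mul_F, FQSym.F_mul_F, FQSym.prodF, FQSym.prodF,
            PermWord.shiftedShuffle_mirror, map_multiset_sum, Multiset.map_map, Multiset.map_map]
          simp only [Function.comp_def, hF])

theorem FQSym.mirror_F {K : Type*} [CommRing K] (σ : PermWord) :
    FQSym.mirror K (FQSym.F K σ) = FQSym.F K (PermWord.mirror σ) :=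
  Module.Basis.equiv_apply ..

/-- The exchange of the two trees of a pair. -/
def TwinPair.swap (J : TwinPair) : TwinPair := ⟨J.1.swap, J.2.swap⟩

theorem TwinPair.swap_swap (J : TwinPair) : J.swap.swap = J := rfl

/-- The exchange of the two trees, as a permutation of the set of pairs of twin binary trees. -/
def TwinPair.swapEquiv : TwinPair ≃ TwinPair :=
  ⟨TwinPair.swap, TwinPair.swap, TwinPair.swap_swap, TwinPair.swap_swap⟩

theorem pShape_mirror_eq_iff {σ : PermWord} {J : TwinPair} :
    pShape (PermWord.mirror σ) = J.swap.1 ↔ pShape σ = J.1 := by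
  rw [pShape_mirror]
  exact Prod.swap_inj

theorem TwinPair.Le.swap {J J' : TwinPair} (h : TwinPair.Le J J') :
    TwinPair.Le J'.swap J.swap := by
  obtain ⟨σ, ν, h, hσ, hν⟩ := h
  exact ⟨_, _, PermWord.le_mirror h, pShape_mirror_eq_iff.2 hν, pShape_mirror_eq_iff.2 hσ⟩

theorem TwinPair.isAntiConnected_swap_iff {J : TwinPair} :
    J.swap.IsAntiConnected ↔ J.IsConnected := by
  constructor
  · intro h σ hσ
    have := h (PermWord.mirror σ) (pShape_mirror_eq_iff.2 hσ)
    rwa [PermWord.IsAntiConnected, PermWord.mirror_mirror] at this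
  · intro h σ hσ
    refine h (PermWord.mirror σ) ?_
    rwa [← pShape_mirror_eq_iff, PermWord.mirror_mirror]

theorem mirror_P [CommRing K] (J : TwinPair) : FQSym.mirror K (P K J) = P K J.swap := by
  classical
  rw [P, P, map_sum]
  refine Finset.sum_nbij' PermWord.mirror PermWord.mirror ?_ ?_
    (fun σ _ => PermWord.mirror_mirror σ) (fun σ _ => PermWord.mirror_mirror σ)
    (fun σ _ => FQSym.mirror_F σ)
  · intro σ
    rw [Finset.mem_filter, Finset.mem_filter, pShape_mirror_eq_iff, PermWord.mem_ofSize,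
      PermWord.mem_ofSize]
    rintro ⟨h, h'⟩
    exact ⟨size_eq_of_pShape (pShape_mirror_eq_iff.2 h'), h'⟩
  · intro σ
    rw [Finset.mem_filter, Finset.mem_filter, PermWord.mem_ofSize, PermWord.mem_ofSize]
    rintro ⟨h, h'⟩
    have h1 := (pShape_mirror_eq_iff (σ := σ) (J := J.swap)).2 h'
    exact ⟨size_eq_of_pShape (J := J) h1, h1⟩

/-- Reversal exchanges the two trees and reverses the Baxter order, so the up-set of `J` becomes the
down-set of `J.swap`. -/
theorem mirror_E [CommRing K] (J : TwinPair) : FQSym.mirror K (E K J) = H K J.swap := by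
  classical
  rw [E, H, map_sum]
  refine Finset.sum_nbij' TwinPair.swap TwinPair.swap ?_ ?_
    (fun J _ => rfl) (fun J _ => rfl) (fun J _ => mirror_P J)
  · intro J'
    rw [Finset.mem_filter, Finset.mem_filter, TwinPair.mem_ofSize, TwinPair.mem_ofSize]
    rintro ⟨h, h'⟩
    exact ⟨h'.swap.size_eq, h'.swap⟩
  · intro J'
    rw [Finset.mem_filter, Finset.mem_filter, TwinPair.mem_ofSize, TwinPair.mem_ofSize]
    rintro ⟨h, h'⟩
    exact ⟨(TwinPair.Le.size_eq (J := J) h'.swap).symm, h'.swap⟩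

theorem H_eq [CommRing K] (J : TwinPair) : H K J = FQSym.mirror K (E K J.swap) :=
  (mirror_E J.swap).symm

theorem H_mul_H [CommRing K] (J₀ J₁ : TwinPair) : H K J₀ * H K J₁ = H K (J₀.backslash J₁) := by
  rw [H_eq, H_eq, H_eq, ← map_mul, E_mul_E]
  rfl

theorem linearIndependent_H [Field K] : LinearIndependent K (H K) := by
  have h := (linearIndependent_E (K := K)).comp _ TwinPair.swapEquiv.injective
  have h' := h.map' (FQSym.mirror K).toLinearEquiv.toLinearMap (LinearEquiv.ker _)
  have hH : H K = FQSym.mirror K ∘ E K ∘ TwinPair.swapEquiv := funext H_eq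
  rw [hH]
  exact h'

theorem span_H_eq_span_P [CommRing K] :
    Submodule.span K (Set.range (H K)) = Submodule.span K (Set.range (P K)) := by
  have h : ∀ X Y : TwinPair → FQSym K, (∀ J, FQSym.mirror K (X J) = Y J.swap) →
      Submodule.span K (Set.range Y) =
        (Submodule.span K (Set.range X)).map (FQSym.mirror K).toLinearEquiv.toLinearMap := by
    intro X Y hXY
    rw [Submodule.map_span, ← Set.range_comp, ← TwinPair.swapEquiv.surjective.range_comp Y]
    exact congrArg (fun Z => Submodule.span K (Set.range Z)) (funext fun J => (hXY J).symm)
  rw [h _ _ mirror_E, h _ _ mirror_P, span_E_eq_span_P]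

theorem bijective_foldr_backslash :
    Function.Bijective fun l : List {J : TwinPair // J.IsAntiConnected} =>
      (l.map Subtype.val).foldr TwinPair.backslash TwinPair.empty := by
  let f : {J : TwinPair // J.IsConnected} ≃ {J : TwinPair // J.IsAntiConnected} :=
    TwinPair.swapEquiv.subtypeEquiv fun _ => TwinPair.isAntiConnected_swap_iff.symm
  have h : ∀ l : List {J : TwinPair // J.IsConnected},
      ((l.map f).map Subtype.val).foldr TwinPair.backslash TwinPair.empty =
        ((l.map Subtype.val).foldr TwinPair.slash TwinPair.empty).swap := by
    intro l
    induction l with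
    | nil => rfl
    | cons J l ih => rw [List.map_cons, List.map_cons, List.foldr_cons, ih]; rfl
  -- Unique factorization is transported along the exchange of trees, which turns $\diagup$ into
  -- $\diagdown$ and connected pairs into anti-connected ones.
  have hb := TwinPair.swapEquiv.bijective.comp bijective_foldr_slash
  have hf : Function.Bijective (List.map f) := (Equiv.listEquivOfEquiv f).bijective
  refine (Function.Bijective.of_comp_iff _ hf).1 ?_
  convert hb using 1
  exact funext h

end BaxterAlg

open BaxterAlg
theorem mainTheorem10 (K : Type*) [Field K] [CharZero K] :
    -- the family `(P_J)` spans the algebra `Baxter`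
    Subalgebra.toSubmodule (Baxter K) = Submodule.span K (Set.range (P K)) ∧
    -- `(E_J)` and `(H_J)` are linear bases of `Baxter`
    (LinearIndependent K (E K) ∧
      Submodule.span K (Set.range (E K)) = Subalgebra.toSubmodule (Baxter K)) ∧
    (LinearIndependent K (H K) ∧
      Submodule.span K (Set.range (H K)) = Subalgebra.toSubmodule (Baxter K)) ∧
    -- these bases are multiplicative
    (∀ J₀ J₁ : TwinPair, E K J₀ * E K J₁ = E K (J₀.slash J₁)) ∧
    (∀ J₀ J₁ : TwinPair, H K J₀ * H K J₁ = H K (J₀.backslash J₁)) ∧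
    -- `Baxter` is free on the `E_J` with `J` connected, and on the `H_J` with `J` anti-connected
    Function.Bijective (FreeAlgebra.lift K
      (fun J : {J : TwinPair // J.IsConnected} => (⟨E K J.1, E_mem K J.1⟩ : Baxter K))) ∧
    Function.Bijective (FreeAlgebra.lift K
      (fun J : {J : TwinPair // J.IsAntiConnected} => (⟨H K J.1, H_mem K J.1⟩ : Baxter K))) := by
  have hE := span_E_eq_span_P.trans (toSubmodule_Baxter (K := K)).symm
  have hH := span_H_eq_span_P.trans (toSubmodule_Baxter (K := K)).symm
  refine ⟨toSubmodule_Baxter, ⟨linearIndependent_E, hE⟩, ⟨linearIndependent_H, hH⟩, E_mul_E,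
    H_mul_H, ?_, ?_⟩
  · exact bijective_lift_Baxter (E K) (E_mem K) linearIndependent_E hE TwinPair.slash
      TwinPair.empty _ E_empty E_mul_E bijective_foldr_slash
  · refine bijective_lift_Baxter (H K) (H_mem K) linearIndependent_H hH TwinPair.backslash
      TwinPair.empty _ ?_ H_mul_H bijective_foldr_backslash
    rw [H_eq]
    exact (congrArg _ E_empty).trans (map_one _)
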